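/- Let $\Phi$ be a field of characteristic different from $2$ and $3$. Algebras over $\Phi$ need not be associative or unital; $(x,y,z)=(xy)z-x(yz)$ denotes the associator. A $(-1,1)$-algebra is an algebra satisfying the identities $(x,y,y)=0$ and $(x,y,z)+(y,z,x)+(z,x,y)=0$. A superalgebra is a $\mathbb Z/2$-graded algebra $A=A_0\oplus A_1$. It is a $(-1,1)$-superalgebra if its Grassmann envelope $A_0\otimes G_0+A_1\otimes G_1$ is a $(-1,1)$-algebra, where $G=G_0\oplus G_1$ is the Grassmann algebra on countably many generators over $\Phi$. Let $F=F_{(-1,1)}[\emptyset;x]$ be the free $(-1,1)$-superalgebra over $\Phi$ on one odd generator $x$. That is, $F$ is a $(-1,1)$-superalgebra, $x\in F_1$, and for each $(-1,1)$-superalgebra $A$ and each $a\in A_1$ there is a unique parity-preserving algebra homomorphism $F\to A$ with $x\mapsto a$. Let $\Phi[T]$ be the polynomial algebra in the variables $T=\{t_0,t_1,\dots\}$, and let $D$ be the derivation of $\Phi[T]$ with $D(t_i)=t_{i+1}$ for all $i\ge 0$. Let $B(\Phi[T],D,t_0)=\Phi[T]\oplus\overline{\Phi[T]}$ be the twisted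 superalgebra of vector type. Here $a\mapsto\bar a$ is a linear isomorphism of $\Phi[T]$ onto a copy $\overline{\Phi[T]}$, the even part is $\Phi[T]$, the odd part is $\overline{\Phi[T]}$, and the multiplication is $$a\times b=ab,\qquad a\times\bar b=\bar a\times b=\overline{ab},\qquad \bar a\times\bar b=t_0ab+2D(a)b+aD(b)\qquad(a,b\in\Phi[T]).$$ Let $B_0(\Phi[T],D,t_0)=\Phi_0[T]\oplus\overline{\Phi[T]}$ be its subsuperalgebra in which $\Phi_0[T]$ is the set of polynomials without constant term. **Theorem 3.1.** There is an isomorphism of superalgebras $F_{(-1,1)}[\emptyset;x]\to B_0(\Phi[T],D,t_0)$ with $x\mapsto\bar 1$. Moreover, if $F^\sharp=\Phi\cdot 1\oplus F$ is the unital hull of $F=F_{(-1,1)}[\emptyset;x]$, with $1$ even, then there is an isomorphism of unital superalgebras $F^\sharp\to B(\Phi[T],D,t_0)$ with $x\mapsto\bar 1$. -/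

import Mathlib

open scoped TensorProduct

universe u v w

noncomputable section

/-! ### Algebras, superalgebras, Grassmann envelopes -/

section Superalgebras

/-- A (not necessarily unital or associative) algebra is a `(-1,1)`-algebra if it is right
alternative, `(x,y,y) = 0`, and satisfies `(x,y,z) + (y,z,x) + (z,x,y) = 0`, where
`(x,y,z) = (xy)z - x(yz)`. -/
structure IsMinusOneOneAlgebra (B : Type*) [NonUnitalNonAssocRing B] : Prop where
  right_alternative : ∀ x y : B, associator x y y = 0
  cyclic : ∀ x y z : B, associator x y z + associator y z x + associator z x y = 0

variable {Φ : Type u} [Field Φ]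

variable {A : Type v} [NonUnitalNonAssocRing A] [Module Φ A]

/-- The pair `𝒜 0`, `𝒜 1` makes the algebra `A` a superalgebra: `A = A₀ ⊕ A₁` as a vector space
and `Aᵢ Aⱼ ⊆ Aᵢ₊ⱼ` (indices mod 2). -/
structure IsSuperalgebra (𝒜 : ZMod 2 → Submodule Φ A) : Prop where
  isCompl : IsCompl (𝒜 0) (𝒜 1)
  mul_mem : ∀ (i j : ZMod 2) (a b : A), a ∈ 𝒜 i → b ∈ 𝒜 j → a * b ∈ 𝒜 (i + j)

variable (Φ) in
/-- The associative unital Grassmann algebra `G` on countably many generators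
`e₀, e₁, …` over `Φ`. -/
abbrev Grassmann : Type u := ExteriorAlgebra Φ (ℕ →₀ Φ)

variable (Φ) in
/-- The standard `ℤ/2`-grading of the Grassmann algebra: products of an even (odd) number of
generators span the even (odd) part. -/
def grassmannGrading (i : ZMod 2) : Submodule Φ (Grassmann Φ) :=
  CliffordAlgebra.evenOdd (0 : QuadraticForm Φ (ℕ →₀ Φ)) i

/-- The subspace `A₀ ⊗ G₀ + A₁ ⊗ G₁` of `A ⊗ G`. -/
def grassmannEnvelopeSubmodule (𝒜 : ZMod 2 → Submodule Φ A) : Submodule Φ (A ⊗[Φ] Grassmann Φ) :=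
  ⨆ i : ZMod 2, Submodule.map₂ (TensorProduct.mk Φ A (Grassmann Φ)) (𝒜 i) (grassmannGrading Φ i)

/-- A homomorphism of algebras is an isomorphism of superalgebras if it is bijective and
preserves (and reflects) the parity of homogeneous elements. -/
structure IsSuperalgebraIso {B : Type w} [NonUnitalNonAssocRing B] [Module Φ B]
    (𝒜 : ZMod 2 → Submodule Φ A) (ℬ : ZMod 2 → Submodule Φ B) (f : A →ₙₐ[Φ] B) : Prop where
  bijective : Function.Bijective f
  mem_iff : ∀ i a, f a ∈ ℬ i ↔ a ∈ 𝒜 i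

/-- The grading of the unital hull `A^♯ = Φ·1 ⊕ A` in which the adjoined unit is even. -/
def hullGrading (𝒜 : ZMod 2 → Submodule Φ A) (i : ZMod 2) : Submodule Φ (Unitization Φ A) :=
  (𝒜 i).map (Unitization.inrHom Φ Φ A) ⊔ (if i = 0 then Submodule.span Φ {1} else ⊥)

variable [IsScalarTower Φ A A] [SMulCommClass Φ A A]

theorem grassmannEnvelopeSubmodule_mul_mem {𝒜 : ZMod 2 → Submodule Φ A} (h : IsSuperalgebra 𝒜)
    {x y : A ⊗[Φ] Grassmann Φ} (hx : x ∈ grassmannEnvelopeSubmodule 𝒜)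
    (hy : y ∈ grassmannEnvelopeSubmodule 𝒜) : x * y ∈ grassmannEnvelopeSubmodule 𝒜 := by
  have key : grassmannEnvelopeSubmodule 𝒜 ≤
      (grassmannEnvelopeSubmodule 𝒜).comap (LinearMap.mulRight Φ y) := by
    refine iSup_le fun i => Submodule.map₂_le.2 fun a ha g hg => ?_
    have key2 : grassmannEnvelopeSubmodule 𝒜 ≤
        (grassmannEnvelopeSubmodule 𝒜).comap (LinearMap.mulLeft Φ (a ⊗ₜ[Φ] g)) := by
      refine iSup_le fun j => Submodule.map₂_le.2 fun b hb k hk => ?_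
      refine Submodule.mem_iSup_of_mem (i + j) ?_
      simp only [TensorProduct.mk_apply, LinearMap.mulLeft_apply,
        Algebra.TensorProduct.tmul_mul_tmul]
      exact Submodule.apply_mem_map₂ _ (h.mul_mem i j a b ha hb)
        (CliffordAlgebra.evenOdd_mul_le _ i j (Submodule.mul_mem_mul hg hk))
    exact key2 hy
  exact key hx

/-- The Grassmann envelope `G(A) = A₀ ⊗ G₀ + A₁ ⊗ G₁`, a subalgebra of `A ⊗ G`. -/
def grassmannEnvelope (𝒜 : ZMod 2 → Submodule Φ A) (h : IsSuperalgebra 𝒜) :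
    NonUnitalSubalgebra Φ (A ⊗[Φ] Grassmann Φ) :=
  { grassmannEnvelopeSubmodule 𝒜 with
    mul_mem' := fun hx hy => grassmannEnvelopeSubmodule_mul_mem h hx hy }

/-- A superalgebra is a `(-1,1)`-superalgebra if its Grassmann envelope is a `(-1,1)`-algebra. -/
def IsMinusOneOneSuperalgebra (𝒜 : ZMod 2 → Submodule Φ A) : Prop :=
  ∃ h : IsSuperalgebra 𝒜, IsMinusOneOneAlgebra (grassmannEnvelope 𝒜 h)

/-- `A` is a free `(-1,1)`-superalgebra on the single odd generator `x` (and no even generators):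
it is a `(-1,1)`-superalgebra, `x` is odd, and for each odd element `b` of each
`(-1,1)`-superalgebra `B` over `Φ` there is exactly one homomorphism of superalgebras `A → B`
with `x ↦ b`. The universe `w` of the test objects `B` is arbitrary. -/
structure IsFreeOnOddGenerator (𝒜 : ZMod 2 → Submodule Φ A) (x : A) : Prop where
  isMinusOneOne : IsMinusOneOneSuperalgebra 𝒜
  odd : x ∈ 𝒜 1
  existsUnique_hom : ∀ (B : Type w) [NonUnitalNonAssocRing B] [Module Φ B] [IsScalarTower Φ B B]
    [SMulCommClass Φ B B] (ℬ : ZMod 2 → Submodule Φ B), IsMinusOneOneSuperalgebra ℬ →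
    ∀ b ∈ ℬ 1, ∃! f : A →ₙₐ[Φ] B, (∀ i, ∀ a ∈ 𝒜 i, f a ∈ ℬ i) ∧ f x = b

end Superalgebras

/-! ### The free `(-1,1)`-superalgebra on one odd generator -/

section Free

variable (Φ : Type u) [Field Φ]

/-- The free nonassociative algebra on one generator. -/
abbrev FreeOne : Type u := FreeNonUnitalNonAssocAlgebra Φ Unit

/-- The grading of the free nonassociative algebra in which the generator is odd: a nonassociative
word is even or odd according to its length. -/
def freeOneGrading (i : ZMod 2) : Submodule Φ (FreeOne Φ) :=
  Submodule.span Φ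
    {m | ∃ q : FreeMagma Unit, (q.length : ZMod 2) = i ∧ m = MonoidAlgebra.ofMagma Φ _ q}

/-- The sign `(-1)^{ij}`. -/
def koszulSign (i j : ZMod 2) : Φ := (-1) ^ (i * j).val

/-- The defining relations of the free `(-1,1)`-superalgebra: the superized (linearized)
identities `(a,b,c) + (-1)^{|b||c|} (a,c,b) = 0` and
`(a,b,c) + (-1)^{|a|(|b|+|c|)} (b,c,a) + (-1)^{|c|(|a|+|b|)} (c,a,b) = 0` on homogeneous elements
of the free nonassociative algebra. -/
inductive FreeRelation : FreeOne Φ → Prop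
  | right_alternative (i j k : ZMod 2) (a b c : FreeOne Φ) (ha : a ∈ freeOneGrading Φ i)
      (hb : b ∈ freeOneGrading Φ j) (hc : c ∈ freeOneGrading Φ k) :
      FreeRelation (associator a b c + koszulSign Φ j k • associator a c b)
  | cyclic (i j k : ZMod 2) (a b c : FreeOne Φ) (ha : a ∈ freeOneGrading Φ i)
      (hb : b ∈ freeOneGrading Φ j) (hc : c ∈ freeOneGrading Φ k) :
      FreeRelation (associator a b c + koszulSign Φ i (j + k) • associator b c a
        + koszulSign Φ k (i + j) • associator c a b)

/-- The two-sided ideal generated by the defining relations: the smallest subspace that contains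
them and is closed under left and right multiplication by arbitrary elements. -/
def freeIdeal : Submodule Φ (FreeOne Φ) :=
  sInf {J | (∀ r, FreeRelation Φ r → r ∈ J) ∧
    ∀ a ∈ J, ∀ m : FreeOne Φ, m * a ∈ J ∧ a * m ∈ J}

variable {Φ} in
theorem freeIdeal_mul_mem {a : FreeOne Φ} (ha : a ∈ freeIdeal Φ) (m : FreeOne Φ) :
    m * a ∈ freeIdeal Φ ∧ a * m ∈ freeIdeal Φ := by
  simp only [freeIdeal, Submodule.mem_sInf] at ha ⊢
  exact ⟨fun J hJ => (hJ.2 a (ha J hJ) m).1, fun J hJ => (hJ.2 a (ha J hJ) m).2⟩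

/-- The free `(-1,1)`-superalgebra `F[∅; x]` on one odd generator. -/
def FreeMinusOneOne : Type u := FreeOne Φ ⧸ freeIdeal Φ

namespace FreeMinusOneOne

instance : AddCommGroup (FreeMinusOneOne Φ) := inferInstanceAs (AddCommGroup (_ ⧸ freeIdeal Φ))

instance : Module Φ (FreeMinusOneOne Φ) := inferInstanceAs (Module Φ (_ ⧸ freeIdeal Φ))

/-- The quotient map. -/
def mk : FreeOne Φ →ₗ[Φ] FreeMinusOneOne Φ := (freeIdeal Φ).mkQ

theorem mk_surjective : Function.Surjective (mk Φ) := (freeIdeal Φ).mkQ_surjective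

theorem mk_eq_mk {a b : FreeOne Φ} : mk Φ a = mk Φ b ↔ a - b ∈ freeIdeal Φ :=
  Submodule.Quotient.eq _

/-- Multiplication of residue classes. -/
instance : Mul (FreeMinusOneOne Φ) where
  mul := Quotient.map₂ (· * ·) (by
    intro a a' ha b b' hb
    replace ha := (Submodule.quotientRel_def _).1 ha
    replace hb := (Submodule.quotientRel_def _).1 hb
    refine (Submodule.quotientRel_def _).2 ?_
    have e : a * b - a' * b' = (a - a') * b + a' * (b - b') := by
      rw [sub_mul, mul_sub]; abel
    rw [e]
    exact add_mem (freeIdeal_mul_mem ha b).2 (freeIdeal_mul_mem hb a').1)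

theorem mk_mul (a b : FreeOne Φ) : mk Φ (a * b) = mk Φ a * mk Φ b := rfl

instance : NonUnitalNonAssocRing (FreeMinusOneOne Φ) where
  left_distrib x y z := by
    obtain ⟨a, rfl⟩ := mk_surjective Φ x
    obtain ⟨b, rfl⟩ := mk_surjective Φ y
    obtain ⟨c, rfl⟩ := mk_surjective Φ z
    simp only [← map_add, ← mk_mul, mul_add]
  right_distrib x y z := by
    obtain ⟨a, rfl⟩ := mk_surjective Φ x
    obtain ⟨b, rfl⟩ := mk_surjective Φ y
    obtain ⟨c, rfl⟩ := mk_surjective Φ z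
    simp only [← map_add, ← mk_mul, add_mul]
  zero_mul x := by
    obtain ⟨a, rfl⟩ := mk_surjective Φ x
    rw [← map_zero (mk Φ), ← mk_mul, zero_mul]
  mul_zero x := by
    obtain ⟨a, rfl⟩ := mk_surjective Φ x
    rw [← map_zero (mk Φ), ← mk_mul, mul_zero]

instance : IsScalarTower Φ (FreeMinusOneOne Φ) (FreeMinusOneOne Φ) where
  smul_assoc r x y := by
    obtain ⟨a, rfl⟩ := mk_surjective Φ x
    obtain ⟨b, rfl⟩ := mk_surjective Φ y
    simp only [smul_eq_mul, ← map_smul, ← mk_mul, smul_mul_assoc]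

instance : SMulCommClass Φ (FreeMinusOneOne Φ) (FreeMinusOneOne Φ) where
  smul_comm r x y := by
    obtain ⟨a, rfl⟩ := mk_surjective Φ x
    obtain ⟨b, rfl⟩ := mk_surjective Φ y
    simp only [smul_eq_mul, ← map_smul, ← mk_mul, mul_smul_comm]

/-- The free generator. -/
def gen : FreeMinusOneOne Φ := mk Φ (FreeNonUnitalNonAssocAlgebra.of Φ ())

/-- The grading of the free superalgebra, induced by the parity of the length of words. -/
def grading (i : ZMod 2) : Submodule Φ (FreeMinusOneOne Φ) := (freeOneGrading Φ i).map (mk Φ)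

end FreeMinusOneOne

end Free

/-! ### Twisted superalgebras of vector type -/

section VectorType

variable {Φ : Type u} [Field Φ] {Γ : Type v} [CommRing Γ] [Algebra Φ Γ]

/-- The twisted superalgebra of vector type `B(Γ, D, γ) = Γ ⊕ Γ̄` of a commutative associative
algebra `Γ` (placed in even degree) with a derivation `D` and an element `γ`: the pair `(a, b)`
stands for `a + b̄`. -/
@[nolint unusedArguments]
def VectorType (_D : Derivation Φ Γ Γ) (_γ : Γ) : Type v := Γ × Γ

namespace VectorType

variable (D : Derivation Φ Γ Γ) (γ : Γ)

instance : AddCommGroup (VectorType D γ) := inferInstanceAs (AddCommGroup (Γ × Γ))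

instance : Module Φ (VectorType D γ) := inferInstanceAs (Module Φ (Γ × Γ))

/-- The copy of `Γ` in `B(Γ, D, γ)`, as a linear map. -/
def incl : Γ →ₗ[Φ] VectorType D γ := LinearMap.inl Φ Γ Γ

/-- The map `a ↦ ā`. -/
def bar : Γ →ₗ[Φ] VectorType D γ := LinearMap.inr Φ Γ Γ

/-- The coordinate `a` of `a + b̄`. -/
def fstₗ : VectorType D γ →ₗ[Φ] Γ := LinearMap.fst Φ Γ Γ

/-- The coordinate `b` of `a + b̄`. -/
def sndₗ : VectorType D γ →ₗ[Φ] Γ := LinearMap.snd Φ Γ Γ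

/-- The multiplication `a × b = ab`, `a × b̄ = ā × b = \overline{ab}`,
`ā × b̄ = γab + 2D(a)b + aD(b)`, extended bilinearly. -/
instance : Mul (VectorType D γ) where
  mul x y := incl D γ (x.1 * y.1 + (γ * x.2 * y.2 + 2 * D x.2 * y.2 + x.2 * D y.2)) +
    bar D γ (x.1 * y.2 + x.2 * y.1)

instance : One (VectorType D γ) where
  one := incl D γ 1

variable {D γ}

theorem ext_coord {x y : VectorType D γ} (h1 : fstₗ D γ x = fstₗ D γ y)
    (h2 : sndₗ D γ x = sndₗ D γ y) : x = y := Prod.ext h1 h2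

@[simp] theorem fst_mul (x y : VectorType D γ) : fstₗ D γ (x * y) =
    fstₗ D γ x * fstₗ D γ y + (γ * sndₗ D γ x * sndₗ D γ y
      + 2 * D (sndₗ D γ x) * sndₗ D γ y + sndₗ D γ x * D (sndₗ D γ y)) := add_zero _

@[simp] theorem snd_mul (x y : VectorType D γ) : sndₗ D γ (x * y) =
    fstₗ D γ x * sndₗ D γ y + sndₗ D γ x * fstₗ D γ y := zero_add _

@[simp] theorem fst_one : fstₗ D γ 1 = 1 := rfl

@[simp] theorem snd_one : sndₗ D γ 1 = 0 := rfl

instance : NonAssocRing (VectorType D γ) where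
  left_distrib x y z := by
    apply ext_coord <;> simp only [fst_mul, snd_mul, map_add] <;> ring
  right_distrib x y z := by
    apply ext_coord <;> simp only [fst_mul, snd_mul, map_add] <;> ring
  zero_mul x := by
    apply ext_coord <;> simp only [fst_mul, snd_mul, map_zero] <;> ring
  mul_zero x := by
    apply ext_coord <;> simp only [fst_mul, snd_mul, map_zero] <;> ring
  one_mul x := by
    apply ext_coord <;> simp only [fst_mul, snd_mul, fst_one, snd_one, map_zero] <;> ring
  mul_one x := by
    apply ext_coord <;> simp only [fst_mul, snd_mul, fst_one, snd_one, map_zero] <;> ring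

instance : IsScalarTower Φ (VectorType D γ) (VectorType D γ) where
  smul_assoc r x y := by
    apply ext_coord <;> simp only [smul_eq_mul, fst_mul, snd_mul, map_smul, Derivation.map_smul] <;>
      simp only [Algebra.smul_def] <;> ring

instance : SMulCommClass Φ (VectorType D γ) (VectorType D γ) where
  smul_comm r x y := by
    apply ext_coord <;> simp only [smul_eq_mul, fst_mul, snd_mul, map_smul, Derivation.map_smul] <;>
      simp only [Algebra.smul_def] <;> ring

variable (D γ)

/-- The grading: `Γ` is the even part and `Γ̄` the odd part. -/
def grading (i : ZMod 2) : Submodule Φ (VectorType D γ) :=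
  if i = 0 then LinearMap.range (incl D γ) else LinearMap.range (bar D γ)

end VectorType

end VectorType

section Polynomials

variable (Φ : Type u) [Field Φ]

/-- The derivation of `Φ[t₀, t₁, …]` with `D(tᵢ) = tᵢ₊₁`. -/
def shiftDerivation : Derivation Φ (MvPolynomial ℕ Φ) (MvPolynomial ℕ Φ) :=
  MvPolynomial.mkDerivation Φ fun i => MvPolynomial.X (i + 1)

/-- The superalgebra `B(Φ[T], D, t₀)`. -/
abbrev PolyVectorType : Type u := VectorType (shiftDerivation Φ) (MvPolynomial.X 0)

variable {Φ} in
theorem constantCoeff_shiftDerivation (p : MvPolynomial ℕ Φ) :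
    MvPolynomial.constantCoeff (shiftDerivation Φ p) = 0 := by
  induction p using MvPolynomial.induction_on with
  | C a => simp [shiftDerivation]
  | add p q hp hq => simp [hp, hq]
  | mul_X p i _ => simp [shiftDerivation]

/-- The subsuperalgebra `B₀(Φ[T], D, t₀) = Φ₀[T] ⊕ \overline{Φ[T]}` of `B(Φ[T], D, t₀)`, where
`Φ₀[T]` consists of the polynomials without constant term. -/
def polyVectorTypeZero : NonUnitalSubalgebra Φ (PolyVectorType Φ) where
  carrier := {u | MvPolynomial.constantCoeff (VectorType.fstₗ _ _ u) = 0}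
  add_mem' := by
    intro a b ha hb
    simp only [Set.mem_ofPred_eq, map_add] at ha hb ⊢
    rw [ha, hb, add_zero]
  zero_mem' := by simp
  mul_mem' := by
    intro a b ha hb
    simp only [Set.mem_ofPred_eq] at ha hb ⊢
    simp [ha, hb, constantCoeff_shiftDerivation]
  smul_mem' := by
    intro c a ha
    simp only [Set.mem_ofPred_eq, map_smul] at ha ⊢
    simp [MvPolynomial.smul_eq_C_mul, ha]

/-- The grading of `B₀(Φ[T], D, t₀)` inherited from `B(Φ[T], D, t₀)`. -/
def polyVectorTypeZeroGrading (i : ZMod 2) : Submodule Φ (polyVectorTypeZero Φ) :=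
  (VectorType.grading (shiftDerivation Φ) (MvPolynomial.X 0) i).comap
    (polyVectorTypeZero Φ).toSubmodule.subtype

/-- The element `1̄` of `B₀(Φ[T], D, t₀)`. -/
def barOne : polyVectorTypeZero Φ :=
  ⟨VectorType.bar _ _ 1, by
    show MvPolynomial.constantCoeff (0 : MvPolynomial ℕ Φ) = 0
    simp⟩

end Polynomials

end

/-! The free superalgebra maps canonically to B₀(Φ[T], D, t₀), since the latter satisfies the
superidentities. All the work lies in a map back. It is built for an arbitrary unital superalgebra U
satisfying the superidentities and an odd x in U, and then used for U = F^♯.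

In B one has 1̄ × 1̄ = t₀ and 1̄ × t̄ᵢ = t₀tᵢ + tᵢ₊₁. Hence tᵢ must go to the element `jetElem x i`
given by x² and the recursion y ↦ x(yx) - x²y. A monomial is sent to the right-nested product of
these elements in increasing order (`jetEven`), and ā to the image of a times x (`jetOdd`). This is
a well-defined linear map; the question is whether it is multiplicative.

The failure is measured by four bilinear defects EE, EO, OE, OO, one for each pair of parities. Give
tᵢ weight i + 1, so that multiplying by t₀ and applying D both raise the weight by one, and count
each bar as half a unit. The induction runs over the resulting half-integral weight. When all
defects of lower weight vanish, the associator of three images equals a combination of defects of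
the current weight plus the image of the associator computed in B. The superidentities hold in U and
in B, so they become linear equations on the defects alone. Two pieces of pure linear algebra,
`odd_defect_eq_zero` (for EO, OE) and `even_defect_eq_zero` (for EE, OO), show that these equations
have only the zero solution. Characteristic 3 is excluded for the first, characteristic 2 for both.

The resulting homomorphism B → F^♯ is inverse to the canonical one: both composites fix the
generators. Restricting to polynomials without constant term gives F ≅ B₀. That the even and odd
parts of F meet only in zero is itself deduced from this isomorphism, so the argument works with the
superidentities (`HasMinusOneOneSuperidentities`) and returns to Grassmann envelopes only where the
definition demands it. -/

noncomputable section

/-! ### Weights on differential polynomials and truncation of bilinear maps. -/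

section Weights

open MvPolynomial

variable {Φ : Type u} [Field Φ]

/-- The weight of the variable `tᵢ` is `i + 1`, so that `D` raises weights by one. -/
def jetWeight (i : ℕ) : ℕ := i + 1

/-- Weighted homogeneity of differential polynomials. -/
abbrev IsJetHom (a : MvPolynomial ℕ Φ) (k : ℕ) : Prop := IsWeightedHomogeneous jetWeight a k

theorem shiftDerivation_X (i : ℕ) : shiftDerivation Φ (X i) = X (i + 1) := by
  simp [shiftDerivation]

theorem isJetHom_X (i : ℕ) : IsJetHom (X i : MvPolynomial ℕ Φ) (i + 1) :=
  isWeightedHomogeneous_X Φ jetWeight i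

theorem isJetHom_one : IsJetHom (1 : MvPolynomial ℕ Φ) 0 := isWeightedHomogeneous_one Φ jetWeight

theorem isJetHom_shiftDerivation {a : MvPolynomial ℕ Φ} {k : ℕ} (ha : IsJetHom a k) :
    IsJetHom (shiftDerivation Φ a) (k + 1) := by
  have key : ∀ s : ℕ →₀ ℕ, IsJetHom (shiftDerivation Φ (monomial s 1))
      (Finsupp.weight jetWeight s + 1) := by
    intro s
    induction s using Finsupp.induction_linear with
    | zero => simpa [shiftDerivation] using isWeightedHomogeneous_zero Φ jetWeight _
    | add s t hs ht =>
      have e : (monomial (s + t) 1 : MvPolynomial ℕ Φ) = monomial s 1 * monomial t 1 := by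
        simp [monomial_mul]
      rw [e, Derivation.leibniz, map_add]
      refine IsWeightedHomogeneous.add ?_ ?_
      · have := (isWeightedHomogeneous_monomial jetWeight s (1 : Φ) rfl).mul ht
        simpa [add_assoc] using this
      · have := (isWeightedHomogeneous_monomial jetWeight t (1 : Φ) rfl).mul hs
        rw [smul_eq_mul]
        convert this using 1
        ring
    | single i n =>
      induction n with
      | zero => simpa [shiftDerivation] using isWeightedHomogeneous_zero Φ jetWeight _
      | succ n ih =>
        have e : (monomial (Finsupp.single i (n + 1)) 1 : MvPolynomial ℕ Φ)
            = monomial (Finsupp.single i n) 1 * X i := by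
          simp [X, monomial_mul]
        rw [e, Derivation.leibniz, shiftDerivation_X, Finsupp.single_add, map_add]
        refine IsWeightedHomogeneous.add ?_ ?_
        · have := (isWeightedHomogeneous_monomial jetWeight (Finsupp.single i n) (1 : Φ) rfl).mul
            (isJetHom_X (i + 1))
          rw [smul_eq_mul]
          convert this using 1
          simp [Finsupp.weight_single, jetWeight, add_assoc]
        · have := (isJetHom_X (Φ := Φ) i).mul ih
          rw [smul_eq_mul]
          convert this using 1
          simp [Finsupp.weight_single, jetWeight]
          ring
  rw [a.as_sum, map_sum]
  refine IsWeightedHomogeneous.sum _ _ _ fun s hs => ?_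
  have e : monomial s (coeff s a) = C (coeff s a) * monomial s 1 := by simp [C_mul_monomial]
  rw [e, ← smul_eq_C_mul, Derivation.map_smul, smul_eq_C_mul, ← ha (mem_support_iff.1 hs)]
  exact (key s).C_mul _

/-- The part of total weight `N` of a bilinear map. -/
def jetTrunc {V : Type v} [AddCommGroup V] [Module Φ V] (N : ℕ)
    (β : MvPolynomial ℕ Φ →ₗ[Φ] MvPolynomial ℕ Φ →ₗ[Φ] V) :
    MvPolynomial ℕ Φ →ₗ[Φ] MvPolynomial ℕ Φ →ₗ[Φ] V :=
  ∑ p ∈ Finset.HasAntidiagonal.antidiagonal N, β.compl₁₂ (weightedHomogeneousComponent jetWeight p.1)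
    (weightedHomogeneousComponent jetWeight p.2)

/-- Truncation isolates one weight layer of a defect as a bilinear map on all of Φ[T], zero in the
other weights. The vanishing lemmas concern whole bilinear maps, and this lets them be applied to a
single layer. -/
theorem jetTrunc_apply {V : Type v} [AddCommGroup V] [Module Φ V] {N : ℕ}
    (β : MvPolynomial ℕ Φ →ₗ[Φ] MvPolynomial ℕ Φ →ₗ[Φ] V) {a b : MvPolynomial ℕ Φ} {k l : ℕ}
    (ha : IsJetHom a k) (hb : IsJetHom b l) :
    jetTrunc N β a b = if k + l = N then β a b else 0 := by
  classical
  simp only [jetTrunc, LinearMap.sum_apply, LinearMap.compl₁₂_apply]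
  rw [Finset.sum_congr rfl (g := fun p => if p = (k, l) then β a b else 0)]
  · simp
  · rintro ⟨p, q⟩ -
    rw [weightedHomogeneousComponent_of_mem ha, weightedHomogeneousComponent_of_mem hb]
    by_cases h1 : p = k <;> by_cases h2 : q = l <;> simp [h1, h2]

theorem jetTrunc_eq {V : Type v} [AddCommGroup V] [Module Φ V] {N : ℕ}
    (β : MvPolynomial ℕ Φ →ₗ[Φ] MvPolynomial ℕ Φ →ₗ[Φ] V) {a b : MvPolynomial ℕ Φ} {k l : ℕ}
    (ha : IsJetHom a k) (hb : IsJetHom b l) (h : k + l = N) : jetTrunc N β a b = β a b := by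
  rw [jetTrunc_apply β ha hb, if_pos h]

/-- Homogeneous of positive weight. -/
def IsJetPos (a : MvPolynomial ℕ Φ) : Prop := ∃ k, IsJetHom a (k + 1)

/-- Homogeneous of some weight. -/
def IsJet (a : MvPolynomial ℕ Φ) : Prop := ∃ k, IsJetHom a k

theorem IsJetPos.isJet {a : MvPolynomial ℕ Φ} (h : IsJetPos a) : IsJet a := ⟨_, h.choose_spec⟩

theorem isJet_one : IsJet (1 : MvPolynomial ℕ Φ) := ⟨0, isJetHom_one⟩

theorem isJetPos_X (i : ℕ) : IsJetPos (X i : MvPolynomial ℕ Φ) := ⟨i, isJetHom_X i⟩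

theorem IsJetPos.mul {a b : MvPolynomial ℕ Φ} (ha : IsJetPos a) (hb : IsJetPos b) :
    IsJetPos (a * b) := by
  obtain ⟨k, ha⟩ := ha
  obtain ⟨l, hb⟩ := hb
  exact ⟨k + 1 + l, ha.mul hb⟩

theorem IsJetPos.deriv {a : MvPolynomial ℕ Φ} (ha : IsJetPos a) :
    IsJetPos (shiftDerivation Φ a) := by
  obtain ⟨k, ha⟩ := ha
  exact ⟨_, isJetHom_shiftDerivation ha⟩

theorem isJetPos_monomial {s : ℕ →₀ ℕ} (hs : s ≠ 0) :
    IsJetPos (monomial s 1 : MvPolynomial ℕ Φ) := by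
  obtain ⟨i, hi⟩ := Finsupp.ne_iff.1 hs
  have : 1 ≤ Finsupp.weight jetWeight s := by
    have h := Finsupp.le_weight jetWeight (s := i) (by simp [jetWeight]) s
    have : s i ≠ 0 := hi
    omega
  refine ⟨Finsupp.weight jetWeight s - 1, isWeightedHomogeneous_monomial jetWeight s 1 ?_⟩
  omega

theorem monomial_eq_X_mul {s : ℕ →₀ ℕ} {i : ℕ} (hi : s i ≠ 0) :
    (monomial s 1 : MvPolynomial ℕ Φ) = X i * monomial (s - Finsupp.single i 1) 1 := by
  have : Finsupp.single i 1 + (s - Finsupp.single i 1) = s := by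
    ext j
    by_cases h : j = i
    · subst h; simp; omega
    · simp [Finsupp.single_eq_of_ne h]
  rw [X, monomial_mul, this, one_mul]

/-- There is no induction hypothesis: the maps of interest vanish on every product of two positive
elements, so splitting off one variable is enough. -/
theorem monomial_induction_pos {p : MvPolynomial ℕ Φ → Prop} (one : p 1) (X : ∀ i, p (X i))
    (mul : ∀ a b, IsJetPos a → IsJetPos b → p (a * b)) (s : ℕ →₀ ℕ) : p (monomial s 1) := by
  by_cases hs : s = 0
  · subst hs; exact one
  · obtain ⟨i, hi⟩ := Finsupp.ne_iff.1 hs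
    rw [monomial_eq_X_mul hi]
    by_cases h : s - Finsupp.single i 1 = 0
    · rw [h]; simpa using X i
    · exact mul _ _ (isJetPos_X i) (isJetPos_monomial h)

end Weights

/-! ### Linear algebra for the defects EO (`L`) and OE (`R`). -/

section OddDefect

open MvPolynomial

variable {Φ : Type u} [Field Φ] {V : Type v} [AddCommGroup V] [Module Φ V]

theorem eq_zero_of_two_smul (h2 : (2 : Φ) ≠ 0) {u : V} (h : (2 : Φ) • u = 0) : u = 0 :=
  (smul_eq_zero.1 h).resolve_left h2

theorem eq_zero_of_three_smul (h3 : (3 : Φ) ≠ 0) {u : V} (h : (3 : Φ) • u = 0) : u = 0 :=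
  (smul_eq_zero.1 h).resolve_left h3

theorem jet_bilinear_eq_zero {β : MvPolynomial ℕ Φ →ₗ[Φ] MvPolynomial ℕ Φ →ₗ[Φ] V}
    (h : ∀ s t, β (monomial s 1) (monomial t 1) = 0) : β = 0 := by
  refine (basisMonomials ℕ Φ).ext fun s => (basisMonomials ℕ Φ).ext fun t => ?_
  simpa using h s t

/-- The associator of three odd elements, in terms of the bilinear maps `L` and `R` that play the
role of the products even by odd and odd by even. -/
def oddAssociator (L R : MvPolynomial ℕ Φ →ₗ[Φ] MvPolynomial ℕ Φ →ₗ[Φ] V)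
    (a b c : MvPolynomial ℕ Φ) : V :=
  (L (X 0 * a * b) c + (2 : Φ) • L (shiftDerivation Φ a * b) c + L (a * shiftDerivation Φ b) c)
  - (R a (X 0 * b * c) + (2 : Φ) • R a (shiftDerivation Φ b * c) + R a (b * shiftDerivation Φ c))

/-- `hI` and `hV` encode the identities on two even and one odd element, `hsymm` and `hcyc` those on
three odd ones. The first pair kills `L` as soon as an argument is a product of positive elements
and reduces `R` to `L` and `R 1`. What remains are the values of `L` on pairs of variables and of `R
1` on variables; the second pair disposes of them. -/
theorem odd_defect_eq_zero (h2 : (2 : Φ) ≠ 0) (h3 : (3 : Φ) ≠ 0)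
    (L R : MvPolynomial ℕ Φ →ₗ[Φ] MvPolynomial ℕ Φ →ₗ[Φ] V)
    (hL1 : ∀ a, L a 1 = 0) (h1L : ∀ a, L 1 a = 0) (hR1 : ∀ a, R a 1 = 0)
    (hI : ∀ a b c, IsJetPos a → IsJetPos b → IsJet c →
      R (a * c) b = (2 : Φ) • L a (b * c) - L (a * b) c)
    (hV : ∀ a b c, IsJetPos a → IsJetPos b → IsJet c →
      R c (a * b) = L a (b * c) + L b (a * c) - L (a * b) c)
    (hsymm : ∀ a b c, IsJet a → IsJet b → IsJet c →
      oddAssociator L R a b c = oddAssociator L R a c b)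
    (hcyc : ∀ a b c, IsJet a → IsJet b → IsJet c →
      oddAssociator L R a b c + oddAssociator L R b c a + oddAssociator L R c a b = 0) :
    L = 0 ∧ R = 0 := by
  have hR : ∀ a b, IsJetPos a → IsJetPos b → R a b = (2 : Φ) • L a b := by
    intro a b ha hb
    have := hI a b 1 ha hb isJet_one
    simpa [hL1] using this
  have hA : ∀ a b c, IsJetPos a → IsJetPos b → IsJetPos c → L (a * b) c = L (a * c) b := by
    intro a b c ha hb hc
    have e1 := hI a b c ha hb hc.isJet
    have e2 := hI a c b ha hc hb.isJet
    rw [hR _ _ (ha.mul hc) hb] at e1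
    rw [hR _ _ (ha.mul hb) hc, mul_comm c b] at e2
    linear_combination (norm := module) e2 - e1
  have hC : ∀ a b c, IsJetPos a → IsJetPos b → IsJetPos c →
      (2 : Φ) • L a (b * c) = (3 : Φ) • L (a * b) c := by
    intro a b c ha hb hc
    have e1 := hI a b c ha hb hc.isJet
    rw [hR _ _ (ha.mul hc) hb, ← hA a b c ha hb hc] at e1
    linear_combination (norm := module) -e1
  -- With λ = L(ab, c), `hA` and `hC` give 2L(a, bc) = 2L(b, ac) = 2L(c, ab) = 3λ, and twice `hV`
  -- then reads 6λ = 4λ.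
  have hprodL : ∀ a b c, IsJetPos a → IsJetPos b → IsJetPos c → L (a * b) c = 0 := by
    intro a b c ha hb hc
    have e := hV a b c ha hb hc.isJet
    rw [hR c _ hc (ha.mul hb)] at e
    have e1 := hC a b c ha hb hc
    have e2 := hC b a c hb ha hc
    have e3 := hC c a b hc ha hb
    rw [mul_comm b a] at e2
    rw [mul_comm c a, hA a c b ha hc hb] at e3
    apply eq_zero_of_two_smul h2
    linear_combination (norm := module) (2 : Φ) • e + e1 + e2 - (2 : Φ) • e3
  have hprodR : ∀ a b c, IsJetPos a → IsJetPos b → IsJetPos c → L a (b * c) = 0 := by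
    intro a b c ha hb hc
    apply eq_zero_of_two_smul h2
    rw [hC a b c ha hb hc, hprodL a b c ha hb hc, smul_zero]
  have hR1prod : ∀ a b, IsJetPos a → IsJetPos b → R 1 (a * b) = L a b + L b a := by
    intro a b ha hb
    have := hV a b 1 ha hb isJet_one
    simpa [hL1] using this
  set D := shiftDerivation Φ with hD
  have hX0 : IsJetPos (X 0 : MvPolynomial ℕ Φ) := isJetPos_X 0
  have D1 : D 1 = 0 := D.map_one_eq_zero
  -- identities for a single positive element
  have hρ : ∀ c, IsJetPos c → R 1 (D c) = - L (X 0) c := by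
    intro c hc
    have := hsymm 1 1 c isJet_one isJet_one hc.isJet
    simp only [oddAssociator, ← hD, D1, mul_one, one_mul, map_zero, hL1, mul_zero, zero_mul,
      LinearMap.zero_apply, smul_zero, add_zero, zero_sub, smul_zero] at this
    linear_combination (norm := module) this
  have hγ : ∀ c, IsJetPos c → L (X 0) c = (2 : Φ) • L c (X 0) := by
    intro c hc
    have e := hcyc 1 1 c isJet_one isJet_one hc.isJet
    simp only [oddAssociator, ← hD, D1, mul_one, one_mul, map_zero, hL1, mul_zero, zero_mul,
      LinearMap.zero_apply, smul_zero, add_zero, zero_sub, smul_zero] at e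
    rw [hR1prod _ _ hX0 hc, hρ c hc, hR c _ hc hX0] at e
    apply sub_eq_zero.1 ∘ eq_zero_of_two_smul h2
    linear_combination (norm := module) e
  have hb1 : ∀ b c, IsJetPos b → IsJetPos c → L b (D c) = L c (D b) := by
    intro b c hb hc
    have e := hsymm 1 b c isJet_one hb.isJet hc.isJet
    simp only [oddAssociator, ← hD, D1, mul_one, one_mul, map_zero, zero_mul,
      LinearMap.zero_apply, smul_zero, add_zero, smul_zero] at e
    rw [hR1prod _ _ (hX0.mul hb) hc, hR1prod _ _ (hX0.mul hc) hb, hR1prod _ _ hb hc.deriv,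
      hR1prod _ _ hb.deriv hc, hR1prod _ _ hc hb.deriv, hR1prod _ _ hc.deriv hb,
      hprodL _ _ _ hX0 hb hc, hprodL _ _ _ hX0 hc hb, hprodR _ _ _ hc hX0 hb,
      hprodR _ _ _ hb hX0 hc] at e
    linear_combination (norm := module) e
  have hb2 : ∀ b c, IsJetPos b → IsJetPos c → L (D b) c = - L b (D c) := by
    intro b c hb hc
    have e := hsymm b 1 c hb.isJet isJet_one hc.isJet
    simp only [oddAssociator, ← hD, D1, mul_one, one_mul, map_zero, hL1, mul_zero, zero_mul,
      LinearMap.zero_apply, smul_zero, add_zero, zero_sub, smul_zero] at e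
    rw [hprodL _ _ _ hX0 hb hc, hR b _ hb (hX0.mul hc), hR b _ hb hc.deriv,
      hprodR _ _ _ hb hX0 hc] at e
    apply sub_eq_zero.1 ∘ eq_zero_of_two_smul h2
    linear_combination (norm := module) e
  -- `hb1` and `hb2` give L(t₀, tₖ₊₁) = L(tₖ, t₁) = -L(tₖ₊₁, t₀), while `hγ` gives L(t₀, tₖ₊₁) =
  -- 2L(tₖ₊₁, t₀); together 3L(t₀, tₖ₊₁) = 0.
  have hX0X : ∀ k, L (X 0) (X k) = 0 := by
    rintro (_ | k)
    · linear_combination (norm := module) -(hγ (X 0) hX0)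
    · have e1 := hb1 (X 0) (X k) hX0 (isJetPos_X k)
      have e2 := hb2 (X k) (X 0) (isJetPos_X k) hX0
      have e3 := hγ (X (k + 1)) (isJetPos_X _)
      simp only [hD, shiftDerivation_X, zero_add] at e1 e2
      apply eq_zero_of_three_smul h3
      linear_combination (norm := module) e3 + (2 : Φ) • e2 + (2 : Φ) • e1
  -- `hb2` lowers the first index at the cost of the second, down to the case of t₀.
  have hXX : ∀ i j, L (X i) (X j) = 0 := by
    intro i
    induction i with
    | zero => exact hX0X
    | succ i ih =>
      intro j
      have := hb2 (X i) (X j) (isJetPos_X i) (isJetPos_X j)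
      simpa only [hD, shiftDerivation_X, ih, neg_zero] using this
  have hL : L = 0 := by
    refine jet_bilinear_eq_zero fun s t => ?_
    refine monomial_induction_pos (p := fun q => L q _ = 0) (h1L _) (fun i => ?_)
      (fun a b ha hb => ?_) s
    · exact monomial_induction_pos (p := fun q => L _ q = 0) (hL1 _) (fun j => hXX i j)
        (fun a b ha hb => hprodR _ _ _ (isJetPos_X i) ha hb) t
    · by_cases ht : t = 0
      · subst ht; exact hL1 _
      · exact hprodL _ _ _ ha hb (isJetPos_monomial ht)
  refine ⟨hL, jet_bilinear_eq_zero fun s t => ?_⟩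
  by_cases ht : t = 0
  · subst ht; exact hR1 _
  by_cases hs : s = 0
  · subst hs
    change R 1 _ = 0
    refine monomial_induction_pos (p := fun q => R 1 q = 0) (hR1 _) (fun i => ?_)
      (fun a b ha hb => ?_) t
    · cases i with
      | zero =>
        -- For the actual defects R(1, t₀) is x·x² - x²·x, and this is the identity 3(x, x, x) = 0.
        have e := hcyc 1 1 1 isJet_one isJet_one isJet_one
        simp only [oddAssociator, ← hD, D1, mul_one, map_zero, hL1, mul_zero,
          LinearMap.zero_apply, smul_zero, add_zero, zero_sub] at e
        apply eq_zero_of_three_smul h3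
        linear_combination (norm := module) -e
      | succ i =>
        have := hρ (X i) (isJetPos_X i)
        simpa only [hD, shiftDerivation_X, hXX, neg_zero] using this
    · rw [hR1prod a b ha hb, hL]; simp
  · rw [hR _ _ (isJetPos_monomial hs) (isJetPos_monomial ht), hL]; simp

end OddDefect

/-! ### Linear algebra for the defects EE (`E`) and OO (`O`). -/

section EvenDefect

open MvPolynomial

variable {Φ : Type u} [Field Φ] {V : Type v} [AddCommGroup V] [Module Φ V]

/-- The value of a linear map `f` at the product `b̄ × c̄`. -/
def barMulBar (f : MvPolynomial ℕ Φ →ₗ[Φ] V) (b c : MvPolynomial ℕ Φ) : V :=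
  f (X 0 * b * c) + (2 : Φ) • f (shiftDerivation Φ b * c) + f (b * shiftDerivation Φ c)

/-- `hE` is right alternativity on three even elements; `hsymm` and `hskew` are right alternativity,
and `hcyc` the cyclic identity, on one even and two odd ones. `hO`, `hPQ` and `hB` below reduce `O`
to `E`, so the point is E = 0. The equations let any variable be moved through `E` as if the product
were commutative and associative. The smallest variable can therefore be brought to the far left,
where `hmin` applies. -/
theorem even_defect_eq_zero (h2 : (2 : Φ) ≠ 0)
    (E O : MvPolynomial ℕ Φ →ₗ[Φ] MvPolynomial ℕ Φ →ₗ[Φ] V)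
    (hE1 : ∀ a, E a 1 = 0) (h1E : ∀ a, E 1 a = 0) (hO1 : O 1 1 = 0) (hOX : ∀ i, O 1 (X i) = 0)
    (hmin : ∀ i s, (∀ j, s j ≠ 0 → i ≤ j) → E (X i) (monomial s 1) = 0)
    (hE : ∀ a b c, IsJetPos a → IsJetPos b → IsJetPos c →
      (2 : Φ) • E a (b * c) = E (a * b) c + E (a * c) b)
    (hsymm : ∀ a b c, IsJetPos a → IsJet b → IsJet c →
      O (a * b) c - barMulBar (E a) b c = O (a * c) b - barMulBar (E a) c b)
    (hskew : ∀ a b c, IsJetPos a → IsJet b → IsJet c →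
      O (a * b) c - O b (a * c) + (barMulBar (E.flip a) b c - O b (a * c)) = 0)
    (hcyc : ∀ a b c, IsJetPos a → IsJet b → IsJet c →
      (O (a * b) c - barMulBar (E a) b c) + (barMulBar (E.flip a) b c - O b (a * c))
        - (O (a * c) b - O c (a * b)) = 0) :
    E = 0 ∧ O = 0 := by
  set D := shiftDerivation Φ with hD
  have hX0 : IsJetPos (X 0 : MvPolynomial ℕ Φ) := isJetPos_X 0
  have D1 : D 1 = 0 := D.map_one_eq_zero
  have hO : ∀ a c, IsJetPos a → IsJet c → O a c = O (a * c) 1 - E a (D c) := by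
    intro a c ha hc
    have e := hsymm a c 1 ha hc isJet_one
    simp only [barMulBar, ← hD, D1, mul_one, one_mul, map_zero, mul_zero, zero_mul, smul_zero] at e
    linear_combination (norm := module) -e
  have hX0comm : ∀ a, IsJetPos a → E a (X 0) = E (X 0) a := by
    intro a ha
    have e := hcyc a 1 1 ha isJet_one isJet_one
    simp only [barMulBar, ← hD, D1, mul_one, map_zero, mul_zero, smul_zero,
      LinearMap.flip_apply] at e
    linear_combination (norm := module) -e
  have hPQ : ∀ a, IsJetPos a → (2 : Φ) • O 1 a = O a 1 + E (X 0) a := by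
    intro a ha
    have e := hskew a 1 1 ha isJet_one isJet_one
    simp only [barMulBar, ← hD, D1, mul_one, map_zero, mul_zero, smul_zero,
      LinearMap.flip_apply] at e
    linear_combination (norm := module) -e
  have hA : ∀ a c, IsJetPos a → IsJetPos c →
      E (D c) a - E a (D c) = E (X 0) (a * c) - E (X 0 * c) a := by
    intro a c ha hc
    have e := hskew a 1 c ha isJet_one hc.isJet
    simp only [barMulBar, ← hD, D1, mul_one, one_mul, map_zero, zero_mul, smul_zero,
      LinearMap.flip_apply, hO a c ha hc.isJet] at e
    linear_combination (norm := module) e + hPQ _ (ha.mul hc)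
  have hB : ∀ a c, IsJetPos a → IsJetPos c →
      O 1 (a * c) = E a (D c) + E c (D a) + E a (X 0 * c) := by
    intro a c ha hc
    have e := hcyc a 1 c ha isJet_one hc.isJet
    simp only [barMulBar, ← hD, D1, mul_one, one_mul, map_zero, zero_mul, smul_zero,
      LinearMap.flip_apply, hO a c ha hc.isJet, hO c a hc ha.isJet, mul_comm c a] at e
    linear_combination (norm := module) e + hPQ _ (ha.mul hc) - hA a c ha hc
  -- `G b` makes E(ba, c) symmetric in the three arguments. It holds for t₀ and passes from b to
  -- D(b), hence holds for every variable.
  let G : MvPolynomial ℕ Φ → Prop := fun b => ∀ a c, IsJetPos a → IsJetPos c →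
    E (b * a) c = E (b * c) a ∧ E (b * a) c = E (a * c) b
  have G0 : G (X 0) := by
    intro a c ha hc
    have e1 := hB a c ha hc
    have e2 := hB c a hc ha
    have e3 := hE a (X 0) c ha hX0 hc
    have e4 := hE c (X 0) a hc hX0 ha
    have e5 := hE (X 0) a c hX0 ha hc
    rw [mul_comm a (X 0)] at e3
    rw [mul_comm c (X 0)] at e4
    rw [mul_comm c a] at e2 e4
    have e6 : E (X 0 * a) c = E (X 0 * c) a := by
      linear_combination (norm := module) e4 - e3 + (2 : Φ) • e2 - (2 : Φ) • e1
    refine ⟨e6, sub_eq_zero.1 (eq_zero_of_two_smul h2 ?_)⟩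
    rw [hX0comm _ (ha.mul hc)]
    linear_combination (norm := module) -e5 + e6
  have Gder : ∀ b, IsJetPos b → G b → G (D b) := by
    intro b hb hG
    have key : ∀ a c, IsJetPos a → IsJetPos c → E (D b * a) c = E (a * c) (D b) := by
      intro a c ha hc
      -- By `hO` both `O`-terms contain the same O(abc, 1), which cancels and leaves a relation in
      -- `E` alone.
      have e := hsymm a b c ha hb.isJet hc.isJet
      have o1 := hO (a * b) c (ha.mul hb) hc.isJet
      have o2 := hO (a * c) b (ha.mul hc) hb.isJet
      rw [show a * c * b = a * b * c by ring] at o2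
      have e1 := hE a (D b) c ha hb.deriv hc
      have e2 := hE a b (D c) ha hb hc.deriv
      have e3 := (hG a (D c) ha hc.deriv).2
      rw [mul_comm b a] at e3
      simp only [barMulBar, ← hD, o1, o2, mul_comm (D c) b, mul_comm c (D b),
        show X 0 * c * b = X 0 * b * c by ring] at e
      rw [mul_comm (D b) a]
      linear_combination (norm := module) -(2 : Φ) • e - e1 + e2 - e3
    intro a c ha hc
    refine ⟨?_, key a c ha hc⟩
    rw [key a c ha hc, key c a hc ha, mul_comm]
  have GX : ∀ i, G (X i) := by
    intro i
    induction i with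
    | zero => exact G0
    | succ i ih => simpa only [hD, shiftDerivation_X] using Gder _ (isJetPos_X i) ih
  have hXcomm : ∀ i a, IsJetPos a → E a (X i) = E (X i) a := by
    intro i a ha
    cases i with
    | zero => exact hX0comm a ha
    | succ i =>
      have hi := isJetPos_X (Φ := Φ) i
      have e1 := hA a (X i) ha hi
      have e2 := hE (X 0) a (X i) hX0 ha hi
      have e3 := (GX 0 a (X i) ha hi).1
      simp only [hD, shiftDerivation_X] at e1
      apply sub_eq_zero.1 ∘ eq_zero_of_two_smul h2
      linear_combination (norm := module) -(2 : Φ) • e1 - e2 - e3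
  have hassoc : ∀ i a c, IsJetPos a → IsJetPos c → E (X i * a) c = E (X i) (a * c) := by
    intro i a c ha hc
    have e1 := hE (X i) a c (isJetPos_X i) ha hc
    have e2 := (GX i a c ha hc).1
    apply sub_eq_zero.1 ∘ eq_zero_of_two_smul h2
    linear_combination (norm := module) e2 - e1
  have hmid : ∀ i a c, IsJetPos a → IsJetPos c → E a (X i * c) = E (X i) (a * c) := by
    intro i a c ha hc
    have e1 := hE a (X i) c ha (isJetPos_X i) hc
    have e2 := (GX i a c ha hc).2
    rw [mul_comm a (X i)] at e1
    rw [← hassoc i a c ha hc]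
    apply sub_eq_zero.1 ∘ eq_zero_of_two_smul h2
    linear_combination (norm := module) e1 - e2
  have hE0 : E = 0 := by
    refine jet_bilinear_eq_zero fun s t => ?_
    by_cases hs : s = 0
    · subst hs; exact h1E _
    by_cases ht : t = 0
    · subst ht; exact hE1 _
    have hex : ∃ i, (s + t) i ≠ 0 := by
      obtain ⟨i, hi⟩ := Finsupp.ne_iff.1 hs
      refine ⟨i, ?_⟩
      rw [Finsupp.coe_zero, Pi.zero_apply] at hi
      rw [Finsupp.add_apply]
      omega
    classical
    -- The least variable occurring in either monomial. Depending on whether it divides the first,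
    -- `hassoc` or one of `hmid`, `hXcomm` moves it to the front.
    set i := Nat.find hex with hi
    have hi0 : (s + t) i ≠ 0 := Nat.find_spec hex
    have hile : ∀ j, s j + t j ≠ 0 → i ≤ j := fun j hj => Nat.find_min' hex (by simpa using hj)
    have hsub : ∀ (p : ℕ →₀ ℕ) j, (p - Finsupp.single i 1 : ℕ →₀ ℕ) j ≠ 0 → p j ≠ 0 := by
      intro p j h h'
      simp [h'] at h
    by_cases hsi : s i = 0
    · have hti : t i ≠ 0 := by simpa [hsi] using hi0
      rw [monomial_eq_X_mul hti]
      by_cases ht' : t - Finsupp.single i 1 = 0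
      · rw [ht', show (monomial (0 : ℕ →₀ ℕ) (1 : Φ)) = 1 from rfl, mul_one,
          hXcomm i _ (isJetPos_monomial hs)]
        exact hmin _ _ fun j hj => hile j (by omega)
      · rw [hmid _ _ _ (isJetPos_monomial hs) (isJetPos_monomial ht'), monomial_mul, one_mul]
        refine hmin _ _ fun j hj => hile j ?_
        have := hsub t j
        rw [Finsupp.add_apply] at hj
        omega
    · rw [monomial_eq_X_mul hsi]
      by_cases hs' : s - Finsupp.single i 1 = 0
      · rw [hs', show (monomial (0 : ℕ →₀ ℕ) (1 : Φ)) = 1 from rfl, mul_one]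
        exact hmin _ _ fun j hj => hile j (by omega)
      · rw [hassoc _ _ _ (isJetPos_monomial hs') (isJetPos_monomial ht), monomial_mul, one_mul]
        refine hmin _ _ fun j hj => hile j ?_
        have := hsub s j
        rw [Finsupp.add_apply] at hj
        omega
  have hQ : ∀ s, O 1 (monomial s 1) = 0 := by
    refine monomial_induction_pos (p := fun q => O 1 q = 0) hO1 hOX fun a b ha hb => ?_
    rw [hB a b ha hb, hE0]; simp
  have hP : ∀ s, O (monomial s 1) 1 = 0 := by
    intro s
    by_cases hs : s = 0
    · subst hs; exact hO1
    · have := hPQ _ (isJetPos_monomial (Φ := Φ) hs)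
      rw [hQ, hE0] at this
      simpa using this.symm
  refine ⟨hE0, jet_bilinear_eq_zero fun s t => ?_⟩
  by_cases hs : s = 0
  · subst hs; exact hQ t
  · rw [hO _ _ (isJetPos_monomial hs) ⟨_, isWeightedHomogeneous_monomial jetWeight t 1 rfl⟩,
      monomial_mul, one_mul, hP, hE0]
    simp

end EvenDefect

/-! ### The candidate map B(Φ[T], D, t₀) → U and its defects. -/

section UnitalHom

open MvPolynomial

variable {Φ : Type u} [Field Φ]

/-- The linearized superidentities that define `(-1,1)`-superalgebras. -/
structure HasMinusOneOneSuperidentities {U : Type v} [NonUnitalNonAssocRing U] [Module Φ U]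
    (𝒰 : ZMod 2 → Submodule Φ U) : Prop where
  right_alternative : ∀ (i j k : ZMod 2) (a b c : U), a ∈ 𝒰 i → b ∈ 𝒰 j → c ∈ 𝒰 k →
    associator a b c + koszulSign Φ j k • associator a c b = 0
  cyclic : ∀ (i j k : ZMod 2) (a b c : U), a ∈ 𝒰 i → b ∈ 𝒰 j → c ∈ 𝒰 k →
    associator a b c + koszulSign Φ i (j + k) • associator b c a
      + koszulSign Φ k (i + j) • associator c a b = 0

theorem koszulSign_zero_left (j : ZMod 2) : koszulSign Φ 0 j = 1 := by simp [koszulSign]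

theorem koszulSign_zero_right (j : ZMod 2) : koszulSign Φ j 0 = 1 := by simp [koszulSign]

theorem koszulSign_one_one : koszulSign Φ 1 1 = -1 := by
  simp [koszulSign, ZMod.val_one]

variable {U : Type v} [NonAssocRing U] [Module Φ U]

/-- The images of the variables `tᵢ` in a unital algebra with a distinguished element `x`. -/
def jetElem (x : U) : ℕ → U
  | 0 => x * x
  | i + 1 => x * (jetElem x i * x) - x * x * jetElem x i

variable (Φ) in
/-- The linear map `Φ[T] → U` that sends a monomial to the right-nested product of the images of
its variables in increasing order. -/
def jetEven (x : U) : MvPolynomial ℕ Φ →ₗ[Φ] U :=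
  (basisMonomials ℕ Φ).constr Φ fun s =>
    ((s.toMultiset.sort (· ≤ ·)).map (jetElem x)).foldr (· * ·) 1

theorem jetEven_monomial (x : U) (s : ℕ →₀ ℕ) : jetEven Φ x (monomial s 1) =
    ((s.toMultiset.sort (· ≤ ·)).map (jetElem x)).foldr (· * ·) 1 := by
  have := (basisMonomials ℕ Φ).constr_basis Φ (fun s : ℕ →₀ ℕ =>
    ((s.toMultiset.sort (· ≤ ·)).map (jetElem x)).foldr (· * ·) 1) s
  simpa only [jetEven, coe_basisMonomials] using this

theorem jetEven_one (x : U) : jetEven Φ x 1 = 1 := by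
  have := jetEven_monomial (Φ := Φ) x 0
  simpa using this

/-- A variable not exceeding the others heads the sorted list. This is the one product rule built
into `jetEven`, and the source of `hmin`. -/
theorem jetEven_X_mul_monomial (x : U) (i : ℕ) (s : ℕ →₀ ℕ) (h : ∀ j, s j ≠ 0 → i ≤ j) :
    jetEven Φ x (X i * monomial s 1) = jetElem x i * jetEven Φ x (monomial s 1) := by
  rw [X, monomial_mul, one_mul, jetEven_monomial, jetEven_monomial, Finsupp.toMultiset_add,
    Finsupp.toMultiset_single, one_smul, Multiset.singleton_add, Multiset.sort_cons]
  · rfl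
  · intro j hj
    rw [Finsupp.mem_toMultiset, Finsupp.mem_support_iff] at hj
    exact h j hj

theorem jetEven_X (x : U) (i : ℕ) : jetEven Φ x (X i) = jetElem x i := by
  have := jetEven_X_mul_monomial (Φ := Φ) x i 0 (by simp)
  simpa [jetEven_one] using this

variable [IsScalarTower Φ U U] [SMulCommClass Φ U U]

variable (Φ) in
/-- The linear map on the odd part that corresponds to `jetEven`. -/
def jetOdd (x : U) : MvPolynomial ℕ Φ →ₗ[Φ] U := (LinearMap.mulRight Φ x).comp (jetEven Φ x)

theorem jetOdd_apply (x : U) (a : MvPolynomial ℕ Φ) : jetOdd Φ x a = jetEven Φ x a * x := rfl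

theorem jetOdd_one (x : U) : jetOdd Φ x 1 = x := by rw [jetOdd_apply, jetEven_one, one_mul]

variable (Φ) in
/-- The defect of multiplicativity on products of even elements. -/
def defectEE (x : U) : MvPolynomial ℕ Φ →ₗ[Φ] MvPolynomial ℕ Φ →ₗ[Φ] U :=
  (LinearMap.mul Φ U).compl₁₂ (jetEven Φ x) (jetEven Φ x) -
    (LinearMap.mul Φ (MvPolynomial ℕ Φ)).compr₂ (jetEven Φ x)

variable (Φ) in
/-- The defect of multiplicativity on products of even by odd elements. -/
def defectEO (x : U) : MvPolynomial ℕ Φ →ₗ[Φ] MvPolynomial ℕ Φ →ₗ[Φ] U :=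
  (LinearMap.mul Φ U).compl₁₂ (jetEven Φ x) (jetOdd Φ x) -
    (LinearMap.mul Φ (MvPolynomial ℕ Φ)).compr₂ (jetOdd Φ x)

variable (Φ) in
/-- The defect of multiplicativity on products of odd by even elements. -/
def defectOE (x : U) : MvPolynomial ℕ Φ →ₗ[Φ] MvPolynomial ℕ Φ →ₗ[Φ] U :=
  (LinearMap.mul Φ U).compl₁₂ (jetOdd Φ x) (jetEven Φ x) -
    (LinearMap.mul Φ (MvPolynomial ℕ Φ)).compr₂ (jetOdd Φ x)

variable (Φ) in
/-- The defect of multiplicativity on products of odd elements. -/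
def defectOO (x : U) : MvPolynomial ℕ Φ →ₗ[Φ] MvPolynomial ℕ Φ →ₗ[Φ] U :=
  LinearMap.mk₂ Φ (fun a b => jetOdd Φ x a * jetOdd Φ x b - barMulBar (jetEven Φ x) a b)
    (fun a a' b => by
      simp only [barMulBar, map_add, mul_add, add_mul, smul_add]; abel)
    (fun r a b => by
      simp only [barMulBar, map_smul, Derivation.map_smul, smul_mul_assoc, mul_smul_comm]
      module)
    (fun a b b' => by
      simp only [barMulBar, map_add, mul_add, smul_add]; abel)
    (fun r a b => by
      simp only [barMulBar, map_smul, Derivation.map_smul, mul_smul_comm]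
      module)

variable {x : U} {a b c : MvPolynomial ℕ Φ}

theorem defectEE_apply :
    defectEE Φ x a b = jetEven Φ x a * jetEven Φ x b - jetEven Φ x (a * b) := rfl

theorem defectEO_apply :
    defectEO Φ x a b = jetEven Φ x a * jetOdd Φ x b - jetOdd Φ x (a * b) := rfl

theorem defectOE_apply :
    defectOE Φ x a b = jetOdd Φ x a * jetEven Φ x b - jetOdd Φ x (a * b) := rfl

theorem defectOO_apply :
    defectOO Φ x a b = jetOdd Φ x a * jetOdd Φ x b - barMulBar (jetEven Φ x) a b := rfl

/-- The formulas of this family expand an associator of images whose two inner products are already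
exact. The result is a combination of defects plus the image of the associator in B. That last term
is zero when at most one argument is odd, and otherwise consists of terms with one derivative. -/
theorem associator_even_even_even (h₁ : defectEE Φ x a b = 0) (h₂ : defectEE Φ x b c = 0) :
    associator (jetEven Φ x a) (jetEven Φ x b) (jetEven Φ x c) =
      defectEE Φ x (a * b) c - defectEE Φ x a (b * c) := by
  rw [defectEE_apply, sub_eq_zero] at h₁ h₂
  rw [associator_apply, h₁, h₂, defectEE_apply, defectEE_apply, mul_assoc]
  abel

theorem associator_even_even_odd (h₁ : defectEE Φ x a b = 0) (h₂ : defectEO Φ x b c = 0) :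
    associator (jetEven Φ x a) (jetEven Φ x b) (jetOdd Φ x c) =
      defectEO Φ x (a * b) c - defectEO Φ x a (b * c) := by
  rw [defectEE_apply, sub_eq_zero] at h₁
  rw [defectEO_apply, sub_eq_zero] at h₂
  rw [associator_apply, h₁, h₂, defectEO_apply, defectEO_apply, mul_assoc]
  abel

theorem associator_even_odd_even (h₁ : defectEO Φ x a b = 0) (h₂ : defectOE Φ x b c = 0) :
    associator (jetEven Φ x a) (jetOdd Φ x b) (jetEven Φ x c) =
      defectOE Φ x (a * b) c - defectEO Φ x a (b * c) := by
  rw [defectEO_apply, sub_eq_zero] at h₁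
  rw [defectOE_apply, sub_eq_zero] at h₂
  rw [associator_apply, h₁, h₂, defectOE_apply, defectEO_apply, mul_assoc]
  abel

theorem associator_odd_even_even (h₁ : defectOE Φ x a b = 0) (h₂ : defectEE Φ x b c = 0) :
    associator (jetOdd Φ x a) (jetEven Φ x b) (jetEven Φ x c) =
      defectOE Φ x (a * b) c - defectOE Φ x a (b * c) := by
  rw [defectOE_apply, sub_eq_zero] at h₁
  rw [defectEE_apply, sub_eq_zero] at h₂
  rw [associator_apply, h₁, h₂, defectOE_apply, defectOE_apply, mul_assoc]
  abel

theorem mul_barMulBar (u : U) (f : MvPolynomial ℕ Φ →ₗ[Φ] U) :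
    u * barMulBar f b c = barMulBar ((LinearMap.mulLeft Φ u).comp f) b c := by
  simp only [barMulBar, mul_add, mul_smul_comm, LinearMap.comp_apply, LinearMap.mulLeft_apply]

theorem barMulBar_mul (u : U) (f : MvPolynomial ℕ Φ →ₗ[Φ] U) :
    barMulBar f b c * u = barMulBar ((LinearMap.mulRight Φ u).comp f) b c := by
  simp only [barMulBar, add_mul, smul_mul_assoc, LinearMap.comp_apply, LinearMap.mulRight_apply]

theorem associator_even_odd_odd (h₁ : defectEO Φ x a b = 0) (h₂ : defectOO Φ x b c = 0) :
    associator (jetEven Φ x a) (jetOdd Φ x b) (jetOdd Φ x c) =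
      defectOO Φ x (a * b) c - barMulBar (defectEE Φ x a) b c
        + (2 : Φ) • jetEven Φ x (shiftDerivation Φ a * b * c) := by
  rw [defectEO_apply, sub_eq_zero] at h₁
  rw [defectOO_apply, sub_eq_zero] at h₂
  rw [associator_apply, h₁, h₂, defectOO_apply, mul_barMulBar]
  simp only [barMulBar, defectEE_apply, LinearMap.comp_apply, LinearMap.mulLeft_apply,
    Derivation.leibniz, smul_eq_mul, add_mul, map_add]
  ring_nf
  module

theorem associator_odd_even_odd (h₁ : defectOE Φ x b a = 0) (h₂ : defectEO Φ x a c = 0) :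
    associator (jetOdd Φ x b) (jetEven Φ x a) (jetOdd Φ x c) =
      defectOO Φ x (a * b) c - defectOO Φ x b (a * c)
        + jetEven Φ x (shiftDerivation Φ a * b * c) := by
  rw [defectOE_apply, sub_eq_zero] at h₁
  rw [defectEO_apply, sub_eq_zero] at h₂
  rw [associator_apply, h₁, h₂, defectOO_apply, defectOO_apply, mul_comm b a]
  simp only [barMulBar, Derivation.leibniz, smul_eq_mul, add_mul, mul_add, map_add]
  ring_nf
  module

theorem associator_odd_odd_even (h₁ : defectOO Φ x b c = 0) (h₂ : defectOE Φ x c a = 0) :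
    associator (jetOdd Φ x b) (jetOdd Φ x c) (jetEven Φ x a) =
      barMulBar ((defectEE Φ x).flip a) b c - defectOO Φ x b (a * c)
        - jetEven Φ x (shiftDerivation Φ a * b * c) := by
  rw [defectOO_apply, sub_eq_zero] at h₁
  rw [defectOE_apply, sub_eq_zero] at h₂
  rw [associator_apply, h₁, h₂, defectOO_apply, barMulBar_mul, mul_comm c a]
  simp only [barMulBar, defectEE_apply, LinearMap.comp_apply, LinearMap.mulRight_apply,
    LinearMap.flip_apply, Derivation.leibniz, smul_eq_mul, mul_add, map_add]
  ring_nf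
  module

theorem associator_odd_odd_odd (h₁ : defectOO Φ x a b = 0) (h₂ : defectOO Φ x b c = 0) :
    associator (jetOdd Φ x a) (jetOdd Φ x b) (jetOdd Φ x c) =
      oddAssociator (defectEO Φ x) (defectOE Φ x) a b c
        + ((2 : Φ) • jetOdd Φ x (shiftDerivation Φ a * b * c)
          - jetOdd Φ x (a * shiftDerivation Φ b * c)
          - jetOdd Φ x (a * b * shiftDerivation Φ c)) := by
  rw [defectOO_apply, sub_eq_zero] at h₁ h₂
  rw [associator_apply, h₁, h₂, barMulBar_mul, mul_barMulBar]
  simp only [barMulBar, oddAssociator, defectEO_apply, defectOE_apply, LinearMap.comp_apply,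
    LinearMap.mulRight_apply, LinearMap.mulLeft_apply]
  ring_nf
  module

end UnitalHom

/-! ### The superidentities force each weight layer of the defects to vanish. -/

section Multiplicativity

open MvPolynomial

variable {Φ : Type u} [Field Φ] {U : Type v} [NonAssocRing U] [Module Φ U]
  [IsScalarTower Φ U U] [SMulCommClass Φ U U] {x : U} {𝒰 : ZMod 2 → Submodule Φ U}

theorem jetElem_mem (hmul : ∀ (i j : ZMod 2) (a b : U), a ∈ 𝒰 i → b ∈ 𝒰 j → a * b ∈ 𝒰 (i + j))
    (hx : x ∈ 𝒰 1) (i : ℕ) : jetElem x i ∈ 𝒰 0 := by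
  induction i with
  | zero => exact hmul 1 1 _ _ hx hx
  | succ i ih =>
    exact sub_mem (hmul 1 1 _ _ hx (hmul 0 1 _ _ ih hx)) (hmul 0 0 _ _ (hmul 1 1 _ _ hx hx) ih)

theorem jetEven_mem (hmul : ∀ (i j : ZMod 2) (a b : U), a ∈ 𝒰 i → b ∈ 𝒰 j → a * b ∈ 𝒰 (i + j))
    (h1 : 1 ∈ 𝒰 0) (hx : x ∈ 𝒰 1) (a : MvPolynomial ℕ Φ) : jetEven Φ x a ∈ 𝒰 0 := by
  have key : ∀ l : List ℕ, (l.map (jetElem x)).foldr (· * ·) 1 ∈ 𝒰 0 := by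
    intro l
    induction l with
    | nil => exact h1
    | cons i l ih => exact hmul 0 0 _ _ (jetElem_mem hmul hx i) ih
  rw [jetEven, Module.Basis.constr_apply]
  exact Submodule.sum_mem _ fun s _ => Submodule.smul_mem _ _ (key _)

theorem jetOdd_mem (hmul : ∀ (i j : ZMod 2) (a b : U), a ∈ 𝒰 i → b ∈ 𝒰 j → a * b ∈ 𝒰 (i + j))
    (h1 : 1 ∈ 𝒰 0) (hx : x ∈ 𝒰 1) (a : MvPolynomial ℕ Φ) : jetOdd Φ x a ∈ 𝒰 1 :=
  hmul 0 1 _ _ (jetEven_mem hmul h1 hx a) hx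

/-- The three terms of b̄ × c̄ have the same weight l + m + 1, so truncation keeps or discards them
together. -/
theorem barMulBar_jetTrunc {N : ℕ} (β : MvPolynomial ℕ Φ →ₗ[Φ] MvPolynomial ℕ Φ →ₗ[Φ] U)
    {a b c : MvPolynomial ℕ Φ} {k l m : ℕ} (ha : IsJetHom a k) (hb : IsJetHom b l)
    (hc : IsJetHom c m) : barMulBar (jetTrunc N β a) b c =
      if k + l + m + 1 = N then barMulBar (β a) b c else 0 := by
  rw [barMulBar, jetTrunc_apply β ha (((isJetHom_X 0).mul hb).mul hc),
    jetTrunc_apply β ha ((isJetHom_shiftDerivation hb).mul hc),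
    jetTrunc_apply β ha (hb.mul (isJetHom_shiftDerivation hc))]
  by_cases h : k + l + m + 1 = N
  · rw [if_pos (by omega), if_pos (by omega), if_pos (by omega), if_pos h, barMulBar]
  · rw [if_neg (by omega), if_neg (by omega), if_neg (by omega), if_neg h, smul_zero, add_zero,
      add_zero]

theorem barMulBar_jetTrunc_flip {N : ℕ} (β : MvPolynomial ℕ Φ →ₗ[Φ] MvPolynomial ℕ Φ →ₗ[Φ] U)
    {a b c : MvPolynomial ℕ Φ} {k l m : ℕ} (ha : IsJetHom a k) (hb : IsJetHom b l)
    (hc : IsJetHom c m) : barMulBar ((jetTrunc N β).flip a) b c =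
      if k + l + m + 1 = N then barMulBar (β.flip a) b c else 0 := by
  simp only [barMulBar, LinearMap.flip_apply]
  rw [jetTrunc_apply β (((isJetHom_X 0).mul hb).mul hc) ha,
    jetTrunc_apply β ((isJetHom_shiftDerivation hb).mul hc) ha,
    jetTrunc_apply β (hb.mul (isJetHom_shiftDerivation hc)) ha]
  by_cases h : k + l + m + 1 = N
  · rw [if_pos (by omega), if_pos (by omega), if_pos (by omega), if_pos h]
  · rw [if_neg (by omega), if_neg (by omega), if_neg (by omega), if_neg h, smul_zero, add_zero,
      add_zero]

theorem oddAssociator_jetTrunc {N : ℕ}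
    (L R : MvPolynomial ℕ Φ →ₗ[Φ] MvPolynomial ℕ Φ →ₗ[Φ] U)
    {a b c : MvPolynomial ℕ Φ} {k l m : ℕ} (ha : IsJetHom a k) (hb : IsJetHom b l)
    (hc : IsJetHom c m) : oddAssociator (jetTrunc N L) (jetTrunc N R) a b c =
      if k + l + m + 1 = N then oddAssociator L R a b c else 0 := by
  have e : ∀ L R : MvPolynomial ℕ Φ →ₗ[Φ] MvPolynomial ℕ Φ →ₗ[Φ] U,
    oddAssociator L R a b c = barMulBar (L.flip c) a b - barMulBar (R a) b c := fun L R => rfl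
  rw [e, e, barMulBar_jetTrunc_flip L hc ha hb, barMulBar_jetTrunc R ha hb hc]
  by_cases h : k + l + m + 1 = N
  · rw [if_pos (by omega), if_pos h, if_pos h]
  · rw [if_neg (by omega), if_neg h, if_neg h, sub_zero]

theorem defectEE_one_right (a : MvPolynomial ℕ Φ) : defectEE Φ x a 1 = 0 := by
  rw [defectEE_apply, jetEven_one, mul_one, mul_one, sub_self]

theorem defectEE_one_left (a : MvPolynomial ℕ Φ) : defectEE Φ x 1 a = 0 := by
  rw [defectEE_apply, jetEven_one, one_mul, one_mul, sub_self]

theorem defectEO_one_right (a : MvPolynomial ℕ Φ) : defectEO Φ x a 1 = 0 := by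
  rw [defectEO_apply, jetOdd_one, mul_one, jetOdd_apply, sub_self]

theorem defectEO_one_left (a : MvPolynomial ℕ Φ) : defectEO Φ x 1 a = 0 := by
  rw [defectEO_apply, jetEven_one, one_mul, one_mul, sub_self]

theorem defectOE_one_right (a : MvPolynomial ℕ Φ) : defectOE Φ x a 1 = 0 := by
  rw [defectOE_apply, jetEven_one, mul_one, mul_one, sub_self]

theorem defectOO_one_one : defectOO Φ x 1 1 = 0 := by
  have : shiftDerivation Φ 1 = 0 := Derivation.map_one_eq_zero _
  rw [defectOO_apply, barMulBar, this, jetOdd_one]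
  simp only [mul_one, mul_zero, map_zero, smul_zero, add_zero]
  rw [jetEven_X, jetElem, sub_self]

/-- True by the recursion defining `jetElem`, which solves 1̄ × t̄ᵢ = t₀tᵢ + tᵢ₊₁ for tᵢ₊₁. The
product t₀tᵢ is sent to the product of the images because t₀ is the least variable. -/
theorem defectOO_one_X (i : ℕ) : defectOO Φ x 1 (X i) = 0 := by
  have : shiftDerivation Φ 1 = 0 := Derivation.map_one_eq_zero _
  have e := jetEven_X_mul_monomial (Φ := Φ) x 0 (Finsupp.single i 1) (by simp)
  rw [defectOO_apply, barMulBar, this, shiftDerivation_X, jetOdd_one, jetOdd_apply]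
  simp only [mul_one, one_mul, zero_mul, map_zero, smul_zero, add_zero]
  rw [X, X, X] at *
  rw [e, ← X, ← X, jetEven_X, jetEven_X, jetElem, jetElem]
  abel

theorem defectEE_min (i : ℕ) (s : ℕ →₀ ℕ) (h : ∀ j, s j ≠ 0 → i ≤ j) :
    defectEE Φ x (X i) (monomial s 1) = 0 := by
  rw [defectEE_apply, jetEven_X_mul_monomial x i s h, jetEven_X, sub_self]

theorem jetTrunc_zero {N : ℕ} {β : MvPolynomial ℕ Φ →ₗ[Φ] MvPolynomial ℕ Φ →ₗ[Φ] U}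
    {a b : MvPolynomial ℕ Φ} (ha : IsJet a) (hb : IsJet b) (h : β a b = 0) :
    jetTrunc N β a b = 0 := by
  obtain ⟨k, ha⟩ := ha
  obtain ⟨l, hb⟩ := hb
  rw [jetTrunc_apply β ha hb, h, ite_self]

theorem isJet_monomial (s : ℕ →₀ ℕ) : IsJet (monomial s 1 : MvPolynomial ℕ Φ) :=
  ⟨_, isWeightedHomogeneous_monomial jetWeight s 1 rfl⟩

/-- To check that a truncated bilinear map vanishes at a fixed argument, monomials suffice. -/
theorem jetTrunc_right_eq_zero {N : ℕ} {β : MvPolynomial ℕ Φ →ₗ[Φ] MvPolynomial ℕ Φ →ₗ[Φ] U}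
    {b : MvPolynomial ℕ Φ} (hb : IsJet b) (h : ∀ a, β a b = 0) (a : MvPolynomial ℕ Φ) :
    jetTrunc N β a b = 0 := by
  suffices (jetTrunc N β).flip b = 0 from LinearMap.congr_fun this a
  refine (basisMonomials ℕ Φ).ext fun s => ?_
  simpa using jetTrunc_zero (isJet_monomial s) hb (h _)

theorem jetTrunc_left_eq_zero {N : ℕ} {β : MvPolynomial ℕ Φ →ₗ[Φ] MvPolynomial ℕ Φ →ₗ[Φ] U}
    {b : MvPolynomial ℕ Φ} (hb : IsJet b) (h : ∀ a, β b a = 0) (a : MvPolynomial ℕ Φ) :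
    jetTrunc N β b a = 0 := by
  suffices jetTrunc N β b = 0 from LinearMap.congr_fun this a
  refine (basisMonomials ℕ Φ).ext fun s => ?_
  simpa using jetTrunc_zero hb (isJet_monomial s) (h _)

/-- EE is treated in weight N + 1 together with OO in weight N, since two bars contribute one unit.
Positivity of the even arguments puts the inner products in lower layers. For EO and OE the layer N
is already needed, so the odd step must come first. -/
theorem defect_even_step (h2 : (2 : Φ) ≠ 0) (hid : HasMinusOneOneSuperidentities 𝒰)
    (hmul : ∀ (i j : ZMod 2) (a b : U), a ∈ 𝒰 i → b ∈ 𝒰 j → a * b ∈ 𝒰 (i + j))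
    (h1 : 1 ∈ 𝒰 0) (hx : x ∈ 𝒰 1) (N : ℕ)
    (hEE : ∀ {a b : MvPolynomial ℕ Φ} {k l}, IsJetHom a k → IsJetHom b l → k + l < N + 1 →
      defectEE Φ x a b = 0)
    (hEO : ∀ {a b : MvPolynomial ℕ Φ} {k l}, IsJetHom a k → IsJetHom b l → k + l < N + 1 →
      defectEO Φ x a b = 0)
    (hOE : ∀ {a b : MvPolynomial ℕ Φ} {k l}, IsJetHom a k → IsJetHom b l → k + l < N + 1 →
      defectOE Φ x a b = 0)
    (hOO : ∀ {a b : MvPolynomial ℕ Φ} {k l}, IsJetHom a k → IsJetHom b l → k + l < N →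
      defectOO Φ x a b = 0) :
    jetTrunc (N + 1) (defectEE Φ x) = 0 ∧ jetTrunc N (defectOO Φ x) = 0 := by
  have me := jetEven_mem hmul h1 hx
  have mo := jetOdd_mem hmul h1 hx
  refine even_defect_eq_zero h2 _ _ (jetTrunc_right_eq_zero isJet_one defectEE_one_right)
    (jetTrunc_left_eq_zero isJet_one defectEE_one_left)
    (jetTrunc_zero isJet_one isJet_one defectOO_one_one)
    (fun i => jetTrunc_zero isJet_one (isJetPos_X i).isJet (defectOO_one_X i))
    (fun i s h => jetTrunc_zero (isJetPos_X i).isJet (isJet_monomial s) (defectEE_min i s h))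
    ?_ ?_ ?_ ?_
  · rintro a b c ⟨k, ha⟩ ⟨l, hb⟩ ⟨m, hc⟩
    rw [jetTrunc_apply _ ha (hb.mul hc), jetTrunc_apply _ (ha.mul hb) hc,
      jetTrunc_apply _ (ha.mul hc) hb]
    by_cases h : k + 1 + (l + 1) + (m + 1) = N + 1
    · rw [if_pos (by omega), if_pos (by omega), if_pos (by omega)]
      have e := hid.right_alternative 0 0 0 _ _ _ (me a) (me b) (me c)
      rw [associator_even_even_even (hEE ha hb (by omega)) (hEE hb hc (by omega)),
        associator_even_even_even (hEE ha hc (by omega)) (hEE hc hb (by omega)),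
        koszulSign_zero_left, mul_comm c b] at e
      linear_combination (norm := module) -e
    · rw [if_neg (by omega), if_neg (by omega), if_neg (by omega)]
      simp
  · rintro a b c ⟨k, ha⟩ ⟨l, hb⟩ ⟨m, hc⟩
    rw [barMulBar_jetTrunc _ ha hb hc, barMulBar_jetTrunc _ ha hc hb,
      jetTrunc_apply _ (ha.mul hb) hc, jetTrunc_apply _ (ha.mul hc) hb]
    by_cases h : k + 1 + l + m = N
    · rw [if_pos (by omega), if_pos (by omega), if_pos (by omega), if_pos (by omega)]
      have e := hid.right_alternative 0 1 1 _ _ _ (me a) (mo b) (mo c)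
      rw [associator_even_odd_odd (hEO ha hb (by omega)) (hOO hb hc (by omega)),
        associator_even_odd_odd (hEO ha hc (by omega)) (hOO hc hb (by omega)),
        koszulSign_one_one, mul_right_comm _ c b] at e
      linear_combination (norm := module) e
    · rw [if_neg (by omega), if_neg (by omega), if_neg (by omega), if_neg (by omega)]
  · rintro a b c ⟨k, ha⟩ ⟨l, hb⟩ ⟨m, hc⟩
    rw [barMulBar_jetTrunc_flip _ ha hb hc,
      jetTrunc_apply _ (ha.mul hb) hc, jetTrunc_apply _ hb (ha.mul hc)]
    by_cases h : k + 1 + l + m = N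
    · rw [if_pos (by omega), if_pos (by omega), if_pos (by omega)]
      have e := hid.right_alternative 1 0 1 _ _ _ (mo b) (me a) (mo c)
      rw [associator_odd_even_odd (hOE hb ha (by omega)) (hEO ha hc (by omega)),
        associator_odd_odd_even (hOO hb hc (by omega)) (hOE hc ha (by omega)),
        koszulSign_zero_left] at e
      linear_combination (norm := module) e
    · rw [if_neg (by omega), if_neg (by omega), if_neg (by omega)]
      simp
  · rintro a b c ⟨k, ha⟩ ⟨l, hb⟩ ⟨m, hc⟩
    rw [barMulBar_jetTrunc _ ha hb hc, barMulBar_jetTrunc_flip _ ha hb hc,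
      jetTrunc_apply _ (ha.mul hb) hc, jetTrunc_apply _ hb (ha.mul hc),
      jetTrunc_apply _ (ha.mul hc) hb, jetTrunc_apply _ hc (ha.mul hb)]
    by_cases h : k + 1 + l + m = N
    · rw [if_pos (by omega), if_pos (by omega), if_pos (by omega), if_pos (by omega),
        if_pos (by omega), if_pos (by omega)]
      have e := hid.cyclic 0 1 1 _ _ _ (me a) (mo b) (mo c)
      rw [associator_even_odd_odd (hEO ha hb (by omega)) (hOO hb hc (by omega)),
        associator_odd_odd_even (hOO hb hc (by omega)) (hOE hc ha (by omega)),
        associator_odd_even_odd (hOE hc ha (by omega)) (hEO ha hb (by omega)),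
        koszulSign_zero_left, zero_add, koszulSign_one_one, mul_right_comm _ c b] at e
      linear_combination (norm := module) e
    · rw [if_neg (by omega), if_neg (by omega), if_neg (by omega), if_neg (by omega),
        if_neg (by omega), if_neg (by omega)]
      simp

theorem defect_odd_step (h2 : (2 : Φ) ≠ 0) (h3 : (3 : Φ) ≠ 0)
    (hid : HasMinusOneOneSuperidentities 𝒰)
    (hmul : ∀ (i j : ZMod 2) (a b : U), a ∈ 𝒰 i → b ∈ 𝒰 j → a * b ∈ 𝒰 (i + j))
    (h1 : 1 ∈ 𝒰 0) (hx : x ∈ 𝒰 1) (N : ℕ)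
    (hEE : ∀ {a b : MvPolynomial ℕ Φ} {k l}, IsJetHom a k → IsJetHom b l → k + l < N + 1 →
      defectEE Φ x a b = 0)
    (hEO : ∀ {a b : MvPolynomial ℕ Φ} {k l}, IsJetHom a k → IsJetHom b l → k + l < N →
      defectEO Φ x a b = 0)
    (hOE : ∀ {a b : MvPolynomial ℕ Φ} {k l}, IsJetHom a k → IsJetHom b l → k + l < N →
      defectOE Φ x a b = 0)
    (hOO : ∀ {a b : MvPolynomial ℕ Φ} {k l}, IsJetHom a k → IsJetHom b l → k + l < N →
      defectOO Φ x a b = 0) :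
    jetTrunc N (defectEO Φ x) = 0 ∧ jetTrunc N (defectOE Φ x) = 0 := by
  have me := jetEven_mem hmul h1 hx
  have mo := jetOdd_mem hmul h1 hx
  have hI : ∀ a b c : MvPolynomial ℕ Φ, IsJetPos a → IsJetPos b → IsJet c →
      jetTrunc N (defectOE Φ x) (a * c) b = (2 : Φ) • jetTrunc N (defectEO Φ x) a (b * c)
        - jetTrunc N (defectEO Φ x) (a * b) c := by
    rintro a b c ⟨k, ha⟩ ⟨l, hb⟩ ⟨m, hc⟩
    rw [jetTrunc_apply _ ha (hb.mul hc), jetTrunc_apply _ (ha.mul hb) hc,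
      jetTrunc_apply _ (ha.mul hc) hb]
    by_cases h : k + 1 + (l + 1) + m = N
    · rw [if_pos (by omega), if_pos (by omega), if_pos (by omega)]
      have e := hid.right_alternative 0 0 1 _ _ _ (me a) (me b) (mo c)
      rw [associator_even_even_odd (hEE ha hb (by omega)) (hEO hb hc (by omega)),
        associator_even_odd_even (hEO ha hc (by omega)) (hOE hc hb (by omega)),
        koszulSign_zero_left, mul_comm c b] at e
      linear_combination (norm := module) e
    · rw [if_neg (by omega), if_neg (by omega), if_neg (by omega)]
      simp
  refine odd_defect_eq_zero h2 h3 _ _ (jetTrunc_right_eq_zero isJet_one defectEO_one_right)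
    (jetTrunc_left_eq_zero isJet_one defectEO_one_left)
    (jetTrunc_right_eq_zero isJet_one defectOE_one_right) hI ?_ ?_ ?_
  · intro a b c ha hb hc
    have i1 := hI a b c ha hb hc
    have i2 := hI b a c hb ha hc
    obtain ⟨k, ha⟩ := ha
    obtain ⟨l, hb⟩ := hb
    obtain ⟨m, hc⟩ := hc
    rw [mul_comm b a] at i2
    -- The cyclic identity yields `h`; substituting `hI` for its two terms R(bc, a) and R(ac, b)
    -- turns it into `hV`.
    suffices h : (jetTrunc N (defectEO Φ x) (a * b) c - jetTrunc N (defectEO Φ x) a (b * c))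
        + (jetTrunc N (defectOE Φ x) (b * c) a - jetTrunc N (defectEO Φ x) b (a * c))
        + (jetTrunc N (defectOE Φ x) (a * c) b - jetTrunc N (defectOE Φ x) c (a * b)) = 0 by
      linear_combination (norm := module) -h + i1 + i2
    rw [jetTrunc_apply _ ha (hb.mul hc), jetTrunc_apply _ (ha.mul hb) hc,
      jetTrunc_apply _ (ha.mul hc) hb, jetTrunc_apply _ hb (ha.mul hc),
      jetTrunc_apply _ hc (ha.mul hb), jetTrunc_apply _ (hb.mul hc) ha]
    by_cases h : k + 1 + (l + 1) + m = N
    · rw [if_pos (by omega), if_pos (by omega), if_pos (by omega), if_pos (by omega),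
        if_pos (by omega), if_pos (by omega)]
      have e := hid.cyclic 0 0 1 _ _ _ (me a) (me b) (mo c)
      rw [associator_even_even_odd (hEE ha hb (by omega)) (hEO hb hc (by omega)),
        associator_even_odd_even (hEO hb hc (by omega)) (hOE hc ha (by omega)),
        associator_odd_even_even (hOE hc ha (by omega)) (hEE ha hb (by omega)),
        koszulSign_zero_left, zero_add, koszulSign_zero_right, mul_comm c a] at e
      linear_combination (norm := module) e
    · rw [if_neg (by omega), if_neg (by omega), if_neg (by omega), if_neg (by omega),
        if_neg (by omega), if_neg (by omega)]
      simp
  · rintro a b c ⟨k, ha⟩ ⟨l, hb⟩ ⟨m, hc⟩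
    rw [oddAssociator_jetTrunc _ _ ha hb hc, oddAssociator_jetTrunc _ _ ha hc hb]
    by_cases h : k + l + m + 1 = N
    · rw [if_pos (by omega), if_pos (by omega)]
      have e := hid.right_alternative 1 1 1 _ _ _ (mo a) (mo b) (mo c)
      rw [associator_odd_odd_odd (hOO ha hb (by omega)) (hOO hb hc (by omega)),
        associator_odd_odd_odd (hOO ha hc (by omega)) (hOO hc hb (by omega)),
        koszulSign_one_one, mul_right_comm _ c b, mul_right_comm _ _ b, mul_right_comm a c] at e
      linear_combination (norm := module) e
    · rw [if_neg (by omega), if_neg (by omega)]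
  · rintro a b c ⟨k, ha⟩ ⟨l, hb⟩ ⟨m, hc⟩
    rw [oddAssociator_jetTrunc _ _ ha hb hc, oddAssociator_jetTrunc _ _ hb hc ha,
      oddAssociator_jetTrunc _ _ hc ha hb]
    by_cases h : k + l + m + 1 = N
    · rw [if_pos (by omega), if_pos (by omega), if_pos (by omega)]
      have e := hid.cyclic 1 1 1 _ _ _ (mo a) (mo b) (mo c)
      rw [associator_odd_odd_odd (hOO ha hb (by omega)) (hOO hb hc (by omega)),
        associator_odd_odd_odd (hOO hb hc (by omega)) (hOO hc ha (by omega)),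
        associator_odd_odd_odd (hOO hc ha (by omega)) (hOO ha hb (by omega)),
        show (1 : ZMod 2) + 1 = 0 from rfl, koszulSign_zero_right] at e
      -- Once the monomials are aligned, the terms coming from associators in B cancel in the cyclic
      -- sum, as 2 - 1 - 1 = 0.
      rw [show shiftDerivation Φ b * c * a = a * shiftDerivation Φ b * c by ring,
        show b * shiftDerivation Φ c * a = a * b * shiftDerivation Φ c by ring,
        show b * c * shiftDerivation Φ a = shiftDerivation Φ a * b * c by ring,
        show shiftDerivation Φ c * a * b = a * b * shiftDerivation Φ c by ring,
        show c * shiftDerivation Φ a * b = shiftDerivation Φ a * b * c by ring,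
        show c * a * shiftDerivation Φ b = a * shiftDerivation Φ b * c by ring] at e
      linear_combination (norm := module) e
    · rw [if_neg (by omega), if_neg (by omega), if_neg (by omega)]
      simp

end Multiplicativity

/-! ### Induction on the weight and the homomorphism out of B(Φ[T], D, t₀). -/

section VectorTypeHom

open MvPolynomial

variable {Φ : Type u} [Field Φ]

theorem isJetHom_zero_eq_C {a : MvPolynomial ℕ Φ} (ha : IsJetHom a 0) : ∃ r, a = C r := by
  refine ⟨coeff 0 a, ?_⟩
  ext s
  rw [coeff_C]
  split_ifs with hs
  · rw [hs]
  · by_contra hne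
    obtain ⟨k, hk⟩ := isJetPos_monomial (Φ := Φ) (Ne.symm hs)
    have h1 : Finsupp.weight jetWeight s = 0 := ha hne
    have h2 : Finsupp.weight jetWeight s = k + 1 := hk (by simp)
    omega

variable {U : Type v} [NonAssocRing U] [Module Φ U]
  [IsScalarTower Φ U U] [SMulCommClass Φ U U] {x : U} {𝒰 : ZMod 2 → Submodule Φ U}

/-- The bound for EE is one higher than the others, in accordance with half a unit per bar. Passing
from N to N + 1 settles EO and OE in weight N, then EE in weight N + 1 and OO in weight N. -/
theorem defects_eq_zero_of_isJetHom (h2 : (2 : Φ) ≠ 0) (h3 : (3 : Φ) ≠ 0)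
    (hid : HasMinusOneOneSuperidentities 𝒰)
    (hmul : ∀ (i j : ZMod 2) (a b : U), a ∈ 𝒰 i → b ∈ 𝒰 j → a * b ∈ 𝒰 (i + j))
    (h1 : 1 ∈ 𝒰 0) (hx : x ∈ 𝒰 1) (N : ℕ) {a b : MvPolynomial ℕ Φ} {k l : ℕ}
    (ha : IsJetHom a k) (hb : IsJetHom b l) :
    (k + l < N + 1 → defectEE Φ x a b = 0) ∧ (k + l < N → defectEO Φ x a b = 0) ∧
    (k + l < N → defectOE Φ x a b = 0) ∧ (k + l < N → defectOO Φ x a b = 0) := by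
  induction N generalizing a b k l with
  | zero =>
    -- Only EE in total weight 0 is claimed here, and there the first argument is a scalar.
    refine ⟨fun h => ?_, by omega, by omega, by omega⟩
    obtain rfl : k = 0 := by omega
    obtain ⟨r, rfl⟩ := isJetHom_zero_eq_C ha
    rw [← mul_one (C r), ← smul_eq_C_mul, map_smul, LinearMap.smul_apply, defectEE_one_left,
      smul_zero]
  | succ N ih =>
    obtain ⟨o1, o2⟩ := defect_odd_step (Φ := Φ) h2 h3 hid hmul h1 hx N
      (fun ha hb h => (ih ha hb).1 h) (fun ha hb h => (ih ha hb).2.1 h)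
      (fun ha hb h => (ih ha hb).2.2.1 h) (fun ha hb h => (ih ha hb).2.2.2 h)
    have hEO : ∀ {a b : MvPolynomial ℕ Φ} {k l}, IsJetHom a k → IsJetHom b l → k + l < N + 1 →
        defectEO Φ x a b = 0 := by
      intro a b k l ha hb h
      by_cases h' : k + l = N
      · rw [← jetTrunc_eq _ ha hb h', o1]; rfl
      · exact (ih ha hb).2.1 (by omega)
    have hOE : ∀ {a b : MvPolynomial ℕ Φ} {k l}, IsJetHom a k → IsJetHom b l → k + l < N + 1 →
        defectOE Φ x a b = 0 := by
      intro a b k l ha hb h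
      by_cases h' : k + l = N
      · rw [← jetTrunc_eq _ ha hb h', o2]; rfl
      · exact (ih ha hb).2.2.1 (by omega)
    obtain ⟨e1, e2⟩ := defect_even_step (Φ := Φ) h2 hid hmul h1 hx N
      (fun ha hb h => (ih ha hb).1 h) hEO hOE (fun ha hb h => (ih ha hb).2.2.2 h)
    refine ⟨fun h => ?_, hEO ha hb, hOE ha hb, fun h => ?_⟩
    · by_cases h' : k + l = N + 1
      · rw [← jetTrunc_eq _ ha hb h', e1]; rfl
      · exact (ih ha hb).1 (by omega)
    · by_cases h' : k + l = N
      · rw [← jetTrunc_eq _ ha hb h', e2]; rfl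
      · exact (ih ha hb).2.2.2 (by omega)

theorem defects_eq_zero (h2 : (2 : Φ) ≠ 0) (h3 : (3 : Φ) ≠ 0)
    (hid : HasMinusOneOneSuperidentities 𝒰)
    (hmul : ∀ (i j : ZMod 2) (a b : U), a ∈ 𝒰 i → b ∈ 𝒰 j → a * b ∈ 𝒰 (i + j))
    (h1 : 1 ∈ 𝒰 0) (hx : x ∈ 𝒰 1) :
    defectEE Φ x = 0 ∧ defectEO Φ x = 0 ∧ defectOE Φ x = 0 ∧ defectOO Φ x = 0 := by
  have key := fun s t : ℕ →₀ ℕ => defects_eq_zero_of_isJetHom (Φ := Φ) h2 h3 hid hmul h1 hx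
    (Finsupp.weight jetWeight s + Finsupp.weight jetWeight t + 1)
    (isWeightedHomogeneous_monomial jetWeight s (1 : Φ) rfl)
    (isWeightedHomogeneous_monomial jetWeight t (1 : Φ) rfl)
  exact ⟨jet_bilinear_eq_zero fun s t => (key s t).1 (by omega),
    jet_bilinear_eq_zero fun s t => (key s t).2.1 (by omega),
    jet_bilinear_eq_zero fun s t => (key s t).2.2.1 (by omega),
    jet_bilinear_eq_zero fun s t => (key s t).2.2.2 (by omega)⟩

/-- For an odd element `x` of a unital `(-1,1)`-superalgebra, the homomorphism from
`B(Φ[T], D, t₀)` with `1̄ ↦ x`. -/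
def polyVectorTypeLift (h2 : (2 : Φ) ≠ 0) (h3 : (3 : Φ) ≠ 0)
    (hid : HasMinusOneOneSuperidentities 𝒰)
    (hmul : ∀ (i j : ZMod 2) (a b : U), a ∈ 𝒰 i → b ∈ 𝒰 j → a * b ∈ 𝒰 (i + j))
    (h1 : 1 ∈ 𝒰 0) (hx : x ∈ 𝒰 1) : PolyVectorType Φ →ₙₐ[Φ] U :=
  { (jetEven Φ x).comp (VectorType.fstₗ _ _) + (jetOdd Φ x).comp (VectorType.sndₗ _ _) with
    map_zero' := map_zero ((jetEven Φ x).comp (VectorType.fstₗ _ _) +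
      (jetOdd Φ x).comp (VectorType.sndₗ (shiftDerivation Φ) (X 0)))
    map_mul' := by
      intro p q
      obtain ⟨d1, d2, d3, d4⟩ := defects_eq_zero (Φ := Φ) h2 h3 hid hmul h1 hx
      have e1 : ∀ a b, jetEven Φ x (a * b) = jetEven Φ x a * jetEven Φ x b := fun a b =>
        (sub_eq_zero.1 (LinearMap.congr_fun₂ d1 a b)).symm
      have e2 : ∀ a b, jetOdd Φ x (a * b) = jetEven Φ x a * jetOdd Φ x b := fun a b =>
        (sub_eq_zero.1 (LinearMap.congr_fun₂ d2 a b)).symm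
      have e3 : ∀ a b, jetOdd Φ x (a * b) = jetOdd Φ x a * jetEven Φ x b := fun a b =>
        (sub_eq_zero.1 (LinearMap.congr_fun₂ d3 a b)).symm
      have e4 : ∀ a b, barMulBar (jetEven Φ x) a b = jetOdd Φ x a * jetOdd Φ x b := fun a b =>
        (sub_eq_zero.1 (LinearMap.congr_fun₂ d4 a b)).symm
      simp only [LinearMap.coe_toAddHom, AddHom.toFun_eq_coe, LinearMap.add_apply, LinearMap.comp_apply, VectorType.fst_mul,
        VectorType.snd_mul, map_add]
      rw [mul_add, add_mul, add_mul, ← e1, ← e2, ← e3, ← e4, barMulBar, mul_assoc 2, two_mul,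
        map_add]
      module }

end VectorTypeHom

/-! ### Superalgebras of vector type satisfy the superidentities. -/

section VectorTypeIdentities

theorem zmod_two_eq (i : ZMod 2) : i = 0 ∨ i = 1 := by revert i; decide

variable {Φ : Type u} [Field Φ] {Γ : Type v} [CommRing Γ] [Algebra Φ Γ] {D : Derivation Φ Γ Γ}
  {γ : Γ}

namespace VectorType

theorem mem_grading_zero {u : VectorType D γ} :
    u ∈ VectorType.grading D γ 0 ↔ sndₗ D γ u = 0 := by
  rw [VectorType.grading, if_pos rfl]
  constructor
  · rintro ⟨a, rfl⟩; rfl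
  · intro h; exact ⟨fstₗ D γ u, ext_coord rfl h.symm⟩

theorem mem_grading_one {u : VectorType D γ} :
    u ∈ VectorType.grading D γ 1 ↔ fstₗ D γ u = 0 := by
  rw [VectorType.grading, if_neg (by decide)]
  constructor
  · rintro ⟨a, rfl⟩; rfl
  · intro h; exact ⟨sndₗ D γ u, ext_coord h.symm rfl⟩

theorem grading_mul_mem (i j : ZMod 2) (a b : VectorType D γ) (ha : a ∈ VectorType.grading D γ i)
    (hb : b ∈ VectorType.grading D γ j) : a * b ∈ VectorType.grading D γ (i + j) := by
  rcases zmod_two_eq i with rfl | rfl <;> rcases zmod_two_eq j with rfl | rfl <;>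
  · simp only [add_zero, zero_add, show (1 : ZMod 2) + 1 = 0 from rfl]
    simp only [mem_grading_zero, mem_grading_one] at ha hb ⊢
    simp [ha, hb]

theorem hasMinusOneOneSuperidentities :
    HasMinusOneOneSuperidentities (VectorType.grading D γ) where
  right_alternative i j k a b c ha hb hc := by
    rcases zmod_two_eq i with rfl | rfl <;> rcases zmod_two_eq j with rfl | rfl <;>
      rcases zmod_two_eq k with rfl | rfl <;>
    · simp only [mem_grading_zero, mem_grading_one] at ha hb hc
      simp only [koszulSign_zero_left, koszulSign_zero_right, koszulSign_one_one, one_smul,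
        neg_smul]
      apply ext_coord <;>
      · simp only [associator_apply, map_add, map_sub, map_neg, fst_mul, snd_mul, ha, hb, hc,
          map_zero, Derivation.leibniz, smul_eq_mul]
        ring
  cyclic i j k a b c ha hb hc := by
    rcases zmod_two_eq i with rfl | rfl <;> rcases zmod_two_eq j with rfl | rfl <;>
      rcases zmod_two_eq k with rfl | rfl <;>
    · simp only [mem_grading_zero, mem_grading_one] at ha hb hc
      simp only [add_zero, zero_add, show (1 : ZMod 2) + 1 = 0 from rfl, koszulSign_zero_left,
        koszulSign_zero_right, koszulSign_one_one, one_smul, neg_smul]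
      apply ext_coord <;>
      · simp only [associator_apply, map_add, map_sub, map_neg, fst_mul, snd_mul, ha, hb, hc,
          map_zero, Derivation.leibniz, smul_eq_mul]
        ring

end VectorType

end VectorTypeIdentities

/-! ### Superidentities and Grassmann envelopes. -/

section Envelope

variable {Φ : Type u} [Field Φ]

theorem koszulSign_comm (i j : ZMod 2) : koszulSign Φ i j = koszulSign Φ j i := by
  rw [koszulSign, koszulSign, mul_comm]

/-- For the zero quadratic form all vectors are orthogonal, so the sign rule for orthogonal Clifford
elements applies to the algebra with itself. -/
theorem grassmann_mul_comm {i j : ZMod 2} {g h : Grassmann Φ} (hg : g ∈ grassmannGrading Φ i)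
    (hh : h ∈ grassmannGrading Φ j) : g * h = koszulSign Φ i j • (h * g) := by
  have := CliffordAlgebra.map_mul_map_of_isOrtho_of_mem_evenOdd
    (QuadraticMap.Isometry.id (0 : QuadraticForm Φ (ℕ →₀ Φ))) (QuadraticMap.Isometry.id _)
    (fun x y => by simp [QuadraticMap.IsOrtho]) g h hg hh
  rw [CliffordAlgebra.map_id] at this
  rcases zmod_two_eq i with rfl | rfl <;> rcases zmod_two_eq j with rfl | rfl <;>
    simpa [koszulSign_zero_left, koszulSign_zero_right, koszulSign_one_one] using this

/-- The determinant of the coordinates a, b, c is an alternating form with value 1 on these three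
basis vectors, so their exterior product cannot vanish. -/
theorem grassmann_ι_mul_ne_zero {a b c : ℕ} (hab : a ≠ b) (hac : a ≠ c) (hbc : b ≠ c) :
    ExteriorAlgebra.ι Φ (Finsupp.single a (1 : Φ)) * (ExteriorAlgebra.ι Φ (Finsupp.single b (1 : Φ))
      * ExteriorAlgebra.ι Φ (Finsupp.single c (1 : Φ))) ≠ 0 := by
  intro h
  let p : (ℕ →₀ Φ) →ₗ[Φ] (Fin 3 → Φ) := LinearMap.pi fun i => Finsupp.lapply (![a, b, c] i)
  let f : ∀ i, (ℕ →₀ Φ) [⋀^Fin i]→ₗ[Φ] Φ := fun i =>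
    if hi : i = 3 then hi ▸ (Matrix.detRowAlternating (n := Fin 3) (R := Φ)).compLinearMap p else 0
  have h1 := ExteriorAlgebra.liftAlternating_apply_ιMulti f
    ![Finsupp.single a (1 : Φ), Finsupp.single b (1 : Φ), Finsupp.single c (1 : Φ)]
  have h2 : ExteriorAlgebra.ιMulti Φ 3
    ![Finsupp.single a (1 : Φ), Finsupp.single b (1 : Φ), Finsupp.single c (1 : Φ)] = 0 := by
    rw [← h, ExteriorAlgebra.ιMulti_apply]
    simp [List.ofFn_succ]
  rw [h2, map_zero] at h1
  have h3 : f 3 = (Matrix.detRowAlternating (n := Fin 3) (R := Φ)).compLinearMap p := by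
    simp [f]
  rw [h3, AlternatingMap.compLinearMap_apply] at h1
  change 0 = Matrix.det (Matrix.of fun i => p (![Finsupp.single a (1 : Φ), Finsupp.single b (1 : Φ),
    Finsupp.single c (1 : Φ)] i)) at h1
  rw [Matrix.det_fin_three] at h1
  simp [p, hab, hac, hbc, hab.symm, hac.symm, hbc.symm] at h1

variable (Φ) in
/-- A nonzero Grassmann element of parity `i` that involves at most the `n`-th generator. -/
def grassmannElem (i : ZMod 2) (n : ℕ) : Grassmann Φ :=
  if i = 0 then 1 else ExteriorAlgebra.ι Φ (Finsupp.single n (1 : Φ))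

theorem grassmannElem_mem (i : ZMod 2) (n : ℕ) : grassmannElem Φ i n ∈ grassmannGrading Φ i := by
  rcases zmod_two_eq i with rfl | rfl
  · rw [grassmannElem, if_pos rfl]
    exact CliffordAlgebra.one_le_evenOdd_zero _ (Submodule.mem_one.2 ⟨1, map_one _⟩)
  · rw [grassmannElem, if_neg (by decide)]
    exact CliffordAlgebra.ι_mem_evenOdd_one _ _

theorem grassmannElem_mul_ne_zero (i j k : ZMod 2) :
    grassmannElem Φ i 0 * grassmannElem Φ j 1 * grassmannElem Φ k 2 ≠ 0 := by
  have e0 : ∀ n, grassmannElem Φ 0 n = 1 := fun n => if_pos rfl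
  have e1 : ∀ n, grassmannElem Φ 1 n = ExteriorAlgebra.ι Φ (Finsupp.single n (1 : Φ)) :=
    fun n => if_neg (by decide)
  have h1 := grassmann_ι_mul_ne_zero (Φ := Φ) (a := 0) (b := 1) (c := 2) (by decide) (by decide)
    (by decide)
  -- For parities 1, 0, 1 the product is e₀e₂, and the missing e₁ has to be multiplied on from
  -- outside, whence the order 1, 0, 2.
  have h2 := grassmann_ι_mul_ne_zero (Φ := Φ) (a := 1) (b := 0) (c := 2) (by decide) (by decide)
    (by decide)
  rcases zmod_two_eq i with rfl | rfl <;> rcases zmod_two_eq j with rfl | rfl <;>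
    rcases zmod_two_eq k with rfl | rfl <;> simp only [e0, e1, one_mul, mul_one] <;> intro h
  · exact one_ne_zero h
  · rw [h, mul_zero, mul_zero] at h1; exact h1 rfl
  · rw [h, zero_mul, mul_zero] at h1; exact h1 rfl
  · rw [h, mul_zero] at h1; exact h1 rfl
  · rw [h, zero_mul] at h1; exact h1 rfl
  · rw [h, mul_zero] at h2; exact h2 rfl
  · rw [← mul_assoc, h, zero_mul] at h1; exact h1 rfl
  · rw [← mul_assoc, h] at h1; exact h1 rfl

theorem eq_zero_of_tmul_eq_zero {A : Type v} [AddCommGroup A] [Module Φ A] {G : Type w}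
    [AddCommGroup G] [Module Φ G] {a : A} {g : G} (hg : g ≠ 0) (h : a ⊗ₜ[Φ] g = 0) : a = 0 := by
  obtain ⟨f, hf⟩ : ∃ f : Module.Dual Φ G, f g ≠ 0 := by
    by_contra! hf
    exact hg ((Module.forall_dual_apply_eq_zero_iff Φ g).1 hf)
  have := congrArg (fun z => TensorProduct.rid Φ A (f.lTensor A z)) h
  simp only [LinearMap.lTensor_tmul, TensorProduct.rid_tmul, map_zero] at this
  exact (smul_eq_zero.1 this).resolve_left hf

variable {A : Type v} [NonUnitalNonAssocRing A] [Module Φ A] [IsScalarTower Φ A A]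
  [SMulCommClass Φ A A] {𝒜 : ZMod 2 → Submodule Φ A}

theorem associator_tmul (a b c : A) (g h k : Grassmann Φ) :
    associator (a ⊗ₜ[Φ] g) (b ⊗ₜ[Φ] h) (c ⊗ₜ[Φ] k) = associator a b c ⊗ₜ[Φ] (g * h * k) := by
  simp only [associator_apply, Algebra.TensorProduct.tmul_mul_tmul, TensorProduct.sub_tmul,
    mul_assoc]

theorem tmul_mem_envelope (hs : IsSuperalgebra 𝒜) {i : ZMod 2} {a : A} {g : Grassmann Φ}
    (ha : a ∈ 𝒜 i) (hg : g ∈ grassmannGrading Φ i) : a ⊗ₜ[Φ] g ∈ grassmannEnvelope 𝒜 hs :=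
  Submodule.mem_iSup_of_mem (p := fun i : ZMod 2 =>
    Submodule.map₂ (TensorProduct.mk Φ A (Grassmann Φ)) (𝒜 i) (grassmannGrading Φ i)) i
    (Submodule.apply_mem_map₂ (TensorProduct.mk Φ A (Grassmann Φ)) ha hg)

theorem IsMinusOneOneAlgebra.associator_add_swap {B : Type w} [NonUnitalNonAssocRing B]
    (h : IsMinusOneOneAlgebra B) (x y z : B) : associator x y z + associator x z y = 0 := by
  have h1 := h.right_alternative x (y + z)
  have h2 := h.right_alternative x y
  have h3 := h.right_alternative x z
  have e : associator x y z + associator x z y =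
      associator x (y + z) (y + z) - associator x y y - associator x z z := by
    simp only [associator_apply, mul_add, add_mul]
    abel
  rw [e, h1, h2, h3]
  simp

theorem grassmann_cyclic {i j k : ZMod 2} {g h l : Grassmann Φ} (hg : g ∈ grassmannGrading Φ i)
    (hh : h ∈ grassmannGrading Φ j) (hl : l ∈ grassmannGrading Φ k) :
    h * l * g = koszulSign Φ i (j + k) • (g * h * l) := by
  rw [koszulSign_comm, mul_assoc g h l]
  exact grassmann_mul_comm (CliffordAlgebra.evenOdd_mul_le (0 : QuadraticForm Φ (ℕ →₀ Φ)) j k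
    (Submodule.mul_mem_mul hh hl)) hg

theorem grassmann_cyclic' {i j k : ZMod 2} {g h l : Grassmann Φ} (hg : g ∈ grassmannGrading Φ i)
    (hh : h ∈ grassmannGrading Φ j) (hl : l ∈ grassmannGrading Φ k) :
    l * g * h = koszulSign Φ k (i + j) • (g * h * l) := by
  rw [mul_assoc l g h]
  exact grassmann_mul_comm hl (CliffordAlgebra.evenOdd_mul_le (0 : QuadraticForm Φ (ℕ →₀ Φ)) i j
    (Submodule.mul_mem_mul hg hh))

theorem grassmann_swap {j k : ZMod 2} (g : Grassmann Φ) {h l : Grassmann Φ}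
    (hh : h ∈ grassmannGrading Φ j) (hl : l ∈ grassmannGrading Φ k) :
    g * l * h = koszulSign Φ j k • (g * h * l) := by
  rw [mul_assoc, grassmann_mul_comm hl hh, koszulSign_comm, mul_smul_comm, mul_assoc]

/-- Tensoring a, b, c with Grassmann elements on distinct generators and reordering the Grassmann
factors produces the Koszul signs. The common factor is nonzero and can be cancelled. -/
theorem IsMinusOneOneSuperalgebra.superidentities (h : IsMinusOneOneSuperalgebra 𝒜) :
    HasMinusOneOneSuperidentities 𝒜 := by
  obtain ⟨hs, hm⟩ := h
  refine ⟨fun i j k a b c ha hb hc => ?_, fun i j k a b c ha hb hc => ?_⟩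
  all_goals
    have hg := grassmannElem_mem (Φ := Φ) i 0
    have hh := grassmannElem_mem (Φ := Φ) j 1
    have hl := grassmannElem_mem (Φ := Φ) k 2
    refine eq_zero_of_tmul_eq_zero (Φ := Φ) (grassmannElem_mul_ne_zero (Φ := Φ) i j k) ?_
  · have e := congrArg Subtype.val (hm.associator_add_swap ⟨_, tmul_mem_envelope hs ha hg⟩
      ⟨_, tmul_mem_envelope hs hb hh⟩ ⟨_, tmul_mem_envelope hs hc hl⟩)
    change associator _ _ _ + associator _ _ _ = (0 : A ⊗[Φ] Grassmann Φ) at e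
    rw [associator_tmul, associator_tmul, grassmann_swap _ hh hl] at e
    rw [TensorProduct.add_tmul, TensorProduct.smul_tmul]
    exact e
  · have e := congrArg Subtype.val (hm.cyclic ⟨_, tmul_mem_envelope hs ha hg⟩
      ⟨_, tmul_mem_envelope hs hb hh⟩ ⟨_, tmul_mem_envelope hs hc hl⟩)
    change associator _ _ _ + associator _ _ _ + associator _ _ _ = (0 : A ⊗[Φ] Grassmann Φ) at e
    rw [associator_tmul, associator_tmul, associator_tmul, grassmann_cyclic hg hh hl,
      grassmann_cyclic' hg hh hl] at e
    rw [TensorProduct.add_tmul, TensorProduct.add_tmul, TensorProduct.smul_tmul,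
      TensorProduct.smul_tmul]
    exact e

/-- Trilinear identities on the Grassmann envelope may be checked on pure tensors. -/
theorem envelope_induction {P : A ⊗[Φ] Grassmann Φ → A ⊗[Φ] Grassmann Φ → A ⊗[Φ] Grassmann Φ →
      A ⊗[Φ] Grassmann Φ}
    (T : A ⊗[Φ] Grassmann Φ →ₗ[Φ] A ⊗[Φ] Grassmann Φ →ₗ[Φ] A ⊗[Φ] Grassmann Φ →ₗ[Φ]
      A ⊗[Φ] Grassmann Φ) (hP : ∀ x y z, T x y z = P x y z)
    (h : ∀ (i j k : ZMod 2) (a b c : A) (g h l : Grassmann Φ), a ∈ 𝒜 i → b ∈ 𝒜 j → c ∈ 𝒜 k →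
      g ∈ grassmannGrading Φ i → h ∈ grassmannGrading Φ j → l ∈ grassmannGrading Φ k →
      P (a ⊗ₜ g) (b ⊗ₜ h) (c ⊗ₜ l) = 0)
    {x y z : A ⊗[Φ] Grassmann Φ} (hx : x ∈ grassmannEnvelopeSubmodule 𝒜)
    (hy : y ∈ grassmannEnvelopeSubmodule 𝒜) (hz : z ∈ grassmannEnvelopeSubmodule 𝒜) :
    P x y z = 0 := by
  rw [← hP]
  have hx' : grassmannEnvelopeSubmodule 𝒜 ≤ LinearMap.ker ((T.flip y).flip z) := by
    refine iSup_le fun i => Submodule.map₂_le.2 fun a ha g hg => ?_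
    have hy' : grassmannEnvelopeSubmodule 𝒜 ≤ LinearMap.ker ((T (a ⊗ₜ g)).flip z) := by
      refine iSup_le fun j => Submodule.map₂_le.2 fun b hb h' hh => ?_
      have hz' : grassmannEnvelopeSubmodule 𝒜 ≤ LinearMap.ker (T (a ⊗ₜ g) (b ⊗ₜ h')) :=
        iSup_le fun k => Submodule.map₂_le.2 fun c hc l hl =>
          LinearMap.mem_ker.2 ((hP _ _ _).trans (h i j k a b c g h' l ha hb hc hg hh hl))
      exact hz' hz
    exact hy' hy
  exact hx' hx

variable (Φ) in
/-- The associator as a trilinear map. -/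
def associatorLin (B : Type w) [NonUnitalNonAssocRing B] [Module Φ B] [IsScalarTower Φ B B]
    [SMulCommClass Φ B B] : B →ₗ[Φ] B →ₗ[Φ] B →ₗ[Φ] B where
  toFun x := LinearMap.mk₂ Φ (fun y z => associator x y z)
    (fun y y' z => by simp only [associator_apply, mul_add, add_mul]; abel)
    (fun r y z => by simp only [associator_apply, smul_mul_assoc, mul_smul_comm, smul_sub])
    (fun y z z' => by simp only [associator_apply, mul_add]; abel)
    (fun r y z => by simp only [associator_apply, mul_smul_comm, smul_sub])
  map_add' x x' := by
    ext y z
    simp only [LinearMap.mk₂_apply, LinearMap.add_apply, associator_apply, add_mul]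
    abel
  map_smul' r x := by
    ext y z
    simp only [LinearMap.mk₂_apply, LinearMap.smul_apply, associator_apply, smul_mul_assoc,
      smul_sub, RingHom.id_apply]

/-- The superidentities give the linearized identities on pure tensors, hence on the envelope.
Recovering (x, y, y) = 0 from its linearization requires dividing by 2. -/
theorem HasMinusOneOneSuperidentities.isMinusOneOneSuperalgebra (h2 : (2 : Φ) ≠ 0)
    (hs : IsSuperalgebra 𝒜) (h : HasMinusOneOneSuperidentities 𝒜) :
    IsMinusOneOneSuperalgebra 𝒜 := by
  let T := associatorLin Φ (A ⊗[Φ] Grassmann Φ)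
  have hRA : ∀ {x y z : A ⊗[Φ] Grassmann Φ}, x ∈ grassmannEnvelopeSubmodule 𝒜 →
      y ∈ grassmannEnvelopeSubmodule 𝒜 → z ∈ grassmannEnvelopeSubmodule 𝒜 →
      associator x y z + associator x z y = 0 := by
    refine envelope_induction (P := fun x y z => associator x y z + associator x z y)
      (T + LinearMap.lflip.toLinearMap.comp T) (fun x y z => rfl) ?_
    intro i j k a b c g h' l ha hb hc hg hh hl
    simp only [associator_tmul]
    rw [grassmann_swap g hh hl, ← TensorProduct.smul_tmul, ← TensorProduct.add_tmul,
      h.right_alternative i j k a b c ha hb hc, TensorProduct.zero_tmul]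
  have hC : ∀ {x y z : A ⊗[Φ] Grassmann Φ}, x ∈ grassmannEnvelopeSubmodule 𝒜 →
      y ∈ grassmannEnvelopeSubmodule 𝒜 → z ∈ grassmannEnvelopeSubmodule 𝒜 →
      associator x y z + associator y z x + associator z x y = 0 := by
    refine envelope_induction
      (P := fun x y z => associator x y z + associator y z x + associator z x y)
      (T + (LinearMap.lflip.toLinearMap.comp T).flip + LinearMap.lflip.toLinearMap.comp T.flip)
      (fun x y z => rfl) ?_
    intro i j k a b c g h' l ha hb hc hg hh hl
    simp only [associator_tmul]
    rw [grassmann_cyclic hg hh hl, grassmann_cyclic' hg hh hl, ← TensorProduct.smul_tmul,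
      ← TensorProduct.smul_tmul, ← TensorProduct.add_tmul, ← TensorProduct.add_tmul,
      h.cyclic i j k a b c ha hb hc, TensorProduct.zero_tmul]
  refine ⟨hs, ⟨fun x y => Subtype.ext ?_, fun x y z => Subtype.ext (hC x.2 y.2 z.2)⟩⟩
  have := hRA x.2 y.2 y.2
  rw [← two_smul Φ] at this
  exact eq_zero_of_two_smul h2 this

end Envelope

/-! ### Universal property of the quotient by the defining relations. -/

section FreeUniversal

variable {Φ : Type u} [Field Φ]

theorem freeOneGrading_mul_mem {i j : ZMod 2} {a b : FreeOne Φ} (ha : a ∈ freeOneGrading Φ i)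
    (hb : b ∈ freeOneGrading Φ j) : a * b ∈ freeOneGrading Φ (i + j) := by
  have h := Submodule.apply_mem_map₂ (LinearMap.mul Φ (FreeOne Φ)) ha hb
  rw [freeOneGrading, freeOneGrading, Submodule.map₂_span_span] at h
  refine Submodule.span_mono ?_ h
  rintro _ ⟨_, ⟨p, hp, rfl⟩, _, ⟨q, hq, rfl⟩, rfl⟩
  refine ⟨p * q, ?_, (map_mul _ p q).symm⟩
  rw [← hp, ← hq, ← Nat.cast_add]
  rfl

theorem freeOneGrading_codisjoint : freeOneGrading Φ 0 ⊔ freeOneGrading Φ 1 = ⊤ := by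
  rw [eq_top_iff]
  intro a _
  have h : a ∈ Submodule.span Φ (Set.range (MonoidAlgebra.ofMagma Φ (FreeMagma Unit))) := by
    induction a using MonoidAlgebra.induction_linear with
    | zero => exact zero_mem _
    | add f g hf hg => exact add_mem (hf trivial) (hg trivial)
    | single q r =>
      have : MonoidAlgebra.single q r = r • MonoidAlgebra.ofMagma Φ (FreeMagma Unit) q := by
        simp [MonoidAlgebra.ofMagma]
      rw [this]
      exact Submodule.smul_mem _ _ (Submodule.subset_span ⟨q, rfl⟩)
  refine Submodule.span_le.2 ?_ h
  rintro _ ⟨q, rfl⟩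
  rcases zmod_two_eq (q.length : ZMod 2) with hq | hq
  · exact Submodule.mem_sup_left (Submodule.subset_span ⟨q, hq, rfl⟩)
  · exact Submodule.mem_sup_right (Submodule.subset_span ⟨q, hq, rfl⟩)

namespace FreeMinusOneOne

theorem grading_mul_mem (i j : ZMod 2) (a b : FreeMinusOneOne Φ) (ha : a ∈ grading Φ i)
    (hb : b ∈ grading Φ j) : a * b ∈ grading Φ (i + j) := by
  obtain ⟨a, ha, rfl⟩ := ha
  obtain ⟨b, hb, rfl⟩ := hb
  exact ⟨a * b, freeOneGrading_mul_mem ha hb, rfl⟩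

theorem gen_mem : gen Φ ∈ grading Φ 1 := by
  refine ⟨_, Submodule.subset_span ⟨FreeMagma.of (), ?_, rfl⟩, rfl⟩
  simp

theorem grading_codisjoint : grading Φ 0 ⊔ grading Φ 1 = ⊤ := by
  rw [grading, grading, ← Submodule.map_sup, freeOneGrading_codisjoint, Submodule.map_top,
    LinearMap.range_eq_top]
  exact mk_surjective Φ

theorem mk_eq_zero_of_relation {r : FreeOne Φ} (h : FreeRelation Φ r) : mk Φ r = 0 := by
  rw [← map_zero (mk Φ), mk_eq_mk, sub_zero, freeIdeal, Submodule.mem_sInf]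
  exact fun J hJ => hJ.1 r h

theorem mk_associator (a b c : FreeOne Φ) :
    mk Φ (associator a b c) = associator (mk Φ a) (mk Φ b) (mk Φ c) := by
  rw [associator_apply, map_sub]
  rfl

theorem superidentities : HasMinusOneOneSuperidentities (grading Φ) where
  right_alternative i j k _ _ _ := by
    rintro ⟨a, ha, rfl⟩ ⟨b, hb, rfl⟩ ⟨c, hc, rfl⟩
    have := mk_eq_zero_of_relation (FreeRelation.right_alternative i j k a b c ha hb hc)
    simpa only [map_add, map_smul, mk_associator] using this
  cyclic i j k _ _ _ := by
    rintro ⟨a, ha, rfl⟩ ⟨b, hb, rfl⟩ ⟨c, hc, rfl⟩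
    have := mk_eq_zero_of_relation (FreeRelation.cyclic i j k a b c ha hb hc)
    simpa only [map_add, map_smul, mk_associator] using this

/-- The quotient map as a homomorphism of algebras. -/
def mkHom : FreeOne Φ →ₙₐ[Φ] FreeMinusOneOne Φ :=
  { mk Φ with
    map_zero' := map_zero (mk Φ)
    map_mul' := mk_mul Φ }

variable {B : Type w} [NonUnitalNonAssocRing B] [Module Φ B] [IsScalarTower Φ B B]
  [SMulCommClass Φ B B] {ℬ : ZMod 2 → Submodule Φ B} {b : B}

theorem hom_ext {f g : FreeMinusOneOne Φ →ₙₐ[Φ] B} (h : f (gen Φ) = g (gen Φ)) : f = g := by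
  have : f.comp mkHom = g.comp mkHom :=
    FreeNonUnitalNonAssocAlgebra.hom_ext Φ fun _ => h
  ext a
  obtain ⟨a, rfl⟩ := mk_surjective Φ a
  exact DFunLike.congr_fun this a

theorem freeLift_mem (hmul : ∀ (i j : ZMod 2) (a b : B), a ∈ ℬ i → b ∈ ℬ j → a * b ∈ ℬ (i + j))
    (hb : b ∈ ℬ 1) {i : ZMod 2} {a : FreeOne Φ} (ha : a ∈ freeOneGrading Φ i) :
    FreeNonUnitalNonAssocAlgebra.lift Φ (fun _ : Unit => b) a ∈ ℬ i := by
  have key : ∀ q : FreeMagma Unit, FreeNonUnitalNonAssocAlgebra.lift Φ (fun _ : Unit => b)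
      (MonoidAlgebra.ofMagma Φ _ q) ∈ ℬ (q.length : ZMod 2) := by
    intro q
    induction q with
    | ih1 x =>
      have := FreeNonUnitalNonAssocAlgebra.lift_of_apply Φ (fun _ : Unit => b) x
      change FreeNonUnitalNonAssocAlgebra.lift Φ (fun _ : Unit => b)
        (MonoidAlgebra.ofMagma Φ _ (FreeMagma.of x)) = b at this
      rw [this]
      simpa using hb
    | ih2 p q hp hq =>
      have := hmul _ _ _ _ hp hq
      rw [← Nat.cast_add, ← map_mul, ← map_mul] at this
      exact this
  induction ha using Submodule.span_induction with
  | mem m hm =>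
    obtain ⟨q, rfl, rfl⟩ := hm
    exact key q
  | zero => rw [map_zero]; exact zero_mem _
  | add m n _ _ hm hn => rw [map_add]; exact add_mem hm hn
  | smul r m _ hm => rw [map_smul]; exact Submodule.smul_mem _ _ hm

theorem map_associator {C : Type v} [NonUnitalNonAssocRing C] [Module Φ C] (f : C →ₙₐ[Φ] B)
    (x y z : C) : f (associator x y z) = associator (f x) (f y) (f z) := by
  simp only [associator_apply, map_sub, map_mul]

/-- The kernel of the lift is one of the two-sided ideals intersected in `freeIdeal`: the lift
respects parity, so each defining relation goes to a superidentity of the target. -/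
theorem freeLift_eq_zero (hid : HasMinusOneOneSuperidentities ℬ)
    (hmul : ∀ (i j : ZMod 2) (a b : B), a ∈ ℬ i → b ∈ ℬ j → a * b ∈ ℬ (i + j))
    (hb : b ∈ ℬ 1) {a : FreeOne Φ} (ha : a ∈ freeIdeal Φ) :
    FreeNonUnitalNonAssocAlgebra.lift Φ (fun _ : Unit => b) a = 0 := by
  set f := FreeNonUnitalNonAssocAlgebra.lift Φ (fun _ : Unit => b)
  let J : Submodule Φ (FreeOne Φ) :=
    { carrier := {a | f a = 0}
      add_mem' := fun {x y} hx hy => by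
        change f (x + y) = 0
        rw [map_add, show f x = 0 from hx, show f y = 0 from hy, add_zero]
      zero_mem' := map_zero f
      smul_mem' := fun r x hx => by
        change f (r • x) = 0
        rw [map_smul, show f x = 0 from hx, smul_zero] }
  have hJ : freeIdeal Φ ≤ J := by
    refine sInf_le ⟨fun r hr => ?_, fun x hx m => ⟨?_, ?_⟩⟩
    · change f r = 0
      cases hr with
      | right_alternative i j k a b c ha hb' hc =>
        rw [map_add, map_smul, map_associator, map_associator]
        exact hid.right_alternative i j k _ _ _ (freeLift_mem hmul hb ha) (freeLift_mem hmul hb hb')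
          (freeLift_mem hmul hb hc)
      | cyclic i j k a b c ha hb' hc =>
        rw [map_add, map_add, map_smul, map_smul, map_associator, map_associator, map_associator]
        exact hid.cyclic i j k _ _ _ (freeLift_mem hmul hb ha) (freeLift_mem hmul hb hb')
          (freeLift_mem hmul hb hc)
    · change f (m * x) = 0
      rw [map_mul, show f x = 0 from hx, mul_zero]
    · change f (x * m) = 0
      rw [map_mul, show f x = 0 from hx, zero_mul]
  exact hJ ha

/-- The homomorphism from the free superalgebra that sends the generator to an odd element. -/
def lift (hid : HasMinusOneOneSuperidentities ℬ)
    (hmul : ∀ (i j : ZMod 2) (a b : B), a ∈ ℬ i → b ∈ ℬ j → a * b ∈ ℬ (i + j))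
    (hb : b ∈ ℬ 1) : FreeMinusOneOne Φ →ₙₐ[Φ] B :=
  let L : FreeMinusOneOne Φ →ₗ[Φ] B := (freeIdeal Φ).liftQ
    (LinearMapClass.linearMap (FreeNonUnitalNonAssocAlgebra.lift Φ (fun _ : Unit => b)))
    fun _ ha => freeLift_eq_zero hid hmul hb ha
  { L with
    map_zero' := map_zero L
    map_mul' := by
      intro x y
      obtain ⟨x, rfl⟩ := mk_surjective Φ x
      obtain ⟨y, rfl⟩ := mk_surjective Φ y
      exact map_mul (FreeNonUnitalNonAssocAlgebra.lift Φ (fun _ : Unit => b)) x y }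

theorem lift_gen (hid : HasMinusOneOneSuperidentities ℬ)
    (hmul : ∀ (i j : ZMod 2) (a b : B), a ∈ ℬ i → b ∈ ℬ j → a * b ∈ ℬ (i + j))
    (hb : b ∈ ℬ 1) : lift hid hmul hb (gen Φ) = b :=
  FreeNonUnitalNonAssocAlgebra.lift_of_apply Φ (fun _ : Unit => b) ()

theorem lift_mem (hid : HasMinusOneOneSuperidentities ℬ)
    (hmul : ∀ (i j : ZMod 2) (a b : B), a ∈ ℬ i → b ∈ ℬ j → a * b ∈ ℬ (i + j))
    (hb : b ∈ ℬ 1) (i : ZMod 2) (a : FreeMinusOneOne Φ) (ha : a ∈ grading Φ i) :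
    lift hid hmul hb a ∈ ℬ i := by
  obtain ⟨a, ha, rfl⟩ := ha
  exact freeLift_mem hmul hb ha

end FreeMinusOneOne

end FreeUniversal

/-! ### Unital hulls inherit the superidentities. -/

section Hull

variable {Φ : Type u} [Field Φ] {A : Type v} [NonUnitalNonAssocRing A] [Module Φ A]
  {𝒜 : ZMod 2 → Submodule Φ A}

theorem mem_hullGrading {i : ZMod 2} {y : Unitization Φ A} :
    y ∈ hullGrading 𝒜 i ↔ y.snd ∈ 𝒜 i ∧ (i = 0 ∨ y.fst = 0) := by
  rw [hullGrading, Submodule.mem_sup]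
  constructor
  · rintro ⟨_, ⟨a, ha, rfl⟩, z, hz, rfl⟩
    split_ifs at hz with h
    · obtain ⟨r, rfl⟩ := Submodule.mem_span_singleton.1 hz
      refine ⟨?_, Or.inl h⟩
      simpa using ha
    · obtain rfl := (Submodule.mem_bot Φ).1 hz
      refine ⟨?_, Or.inr ?_⟩
      · simpa using ha
      · simp
  · rintro ⟨h, h'⟩
    refine ⟨Unitization.inr y.snd, ⟨y.snd, h, rfl⟩, y.fst • 1, ?_, ?_⟩
    · split_ifs with hi
      · exact Submodule.smul_mem _ _ (Submodule.mem_span_singleton_self _)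
      · rw [h'.resolve_left hi, zero_smul]
        exact zero_mem _
    · ext <;> simp

theorem one_mem_hullGrading : (1 : Unitization Φ A) ∈ hullGrading 𝒜 0 :=
  mem_hullGrading.2 ⟨by simp, Or.inl rfl⟩

theorem inr_mem_hullGrading {i : ZMod 2} {a : A} :
    (Unitization.inr a : Unitization Φ A) ∈ hullGrading 𝒜 i ↔ a ∈ 𝒜 i := by
  rw [mem_hullGrading]
  simp

theorem hullGrading_mul_mem
    (hmul : ∀ (i j : ZMod 2) (a b : A), a ∈ 𝒜 i → b ∈ 𝒜 j → a * b ∈ 𝒜 (i + j)) (i j : ZMod 2)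
    (a b : Unitization Φ A) (ha : a ∈ hullGrading 𝒜 i) (hb : b ∈ hullGrading 𝒜 j) :
    a * b ∈ hullGrading 𝒜 (i + j) := by
  rw [mem_hullGrading] at ha hb ⊢
  obtain ⟨ha, ha'⟩ := ha
  obtain ⟨hb, hb'⟩ := hb
  rw [Unitization.snd_mul, Unitization.fst_mul]
  refine ⟨add_mem (add_mem ?_ ?_) (hmul i j _ _ ha hb), ?_⟩
  · rcases ha' with rfl | h
    · rw [zero_add]; exact Submodule.smul_mem _ _ hb
    · rw [h, zero_smul]; exact zero_mem _
  · rcases hb' with rfl | h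
    · rw [add_zero]; exact Submodule.smul_mem _ _ ha
    · rw [h, zero_smul]; exact zero_mem _
  · rcases ha' with rfl | h
    · rcases hb' with rfl | h
      · left; rw [add_zero]
      · right; rw [h, mul_zero]
    · right; rw [h, zero_mul]

variable [IsScalarTower Φ A A] [SMulCommClass Φ A A]

/-- An associator with a scalar argument vanishes, so by trilinearity only the nonunital components
matter. -/
theorem unitization_associator (y z t : Unitization Φ A) :
    associator y z t = Unitization.inr (associator y.snd z.snd t.snd) := by
  refine Unitization.ext ?_ ?_
  · simp only [associator_apply, sub_eq_add_neg, Unitization.fst_add, Unitization.fst_neg,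
      Unitization.fst_mul, Unitization.fst_inr]
    ring
  · simp only [associator_apply, sub_eq_add_neg, Unitization.snd_add, Unitization.snd_neg,
      Unitization.snd_mul, Unitization.fst_mul, Unitization.snd_inr, mul_add, add_mul,
      smul_mul_assoc, mul_smul_comm, smul_add]
    module

theorem hullGrading_superidentities (hid : HasMinusOneOneSuperidentities 𝒜) :
    HasMinusOneOneSuperidentities (hullGrading 𝒜) where
  right_alternative i j k a b c ha hb hc := by
    rw [unitization_associator, unitization_associator, ← Unitization.inr_smul,
      ← Unitization.inr_add, hid.right_alternative i j k _ _ _ (mem_hullGrading.1 ha).1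
        (mem_hullGrading.1 hb).1 (mem_hullGrading.1 hc).1, Unitization.inr_zero]
  cyclic i j k a b c ha hb hc := by
    rw [unitization_associator, unitization_associator, unitization_associator,
      ← Unitization.inr_smul, ← Unitization.inr_smul, ← Unitization.inr_add, ← Unitization.inr_add,
      hid.cyclic i j k _ _ _ (mem_hullGrading.1 ha).1
        (mem_hullGrading.1 hb).1 (mem_hullGrading.1 hc).1, Unitization.inr_zero]

/-- The extension of a homomorphism to the unital hull. -/
def unitizationLift {B : Type w} [NonAssocRing B] [Module Φ B] [IsScalarTower Φ B B]
    [SMulCommClass Φ B B] (f : A →ₙₐ[Φ] B) : Unitization Φ A →ₙₐ[Φ] B where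
  toFun y := y.fst • 1 + f y.snd
  map_zero' := by simp
  map_add' y z := by
    simp only [Unitization.fst_add, Unitization.snd_add, map_add]
    module
  map_smul' r y := by
    simp only [Unitization.fst_smul, Unitization.snd_smul, map_smul, MonoidHom.id_apply]
    module
  map_mul' y z := by
    simp only [Unitization.fst_mul, Unitization.snd_mul, map_add, map_smul, map_mul, mul_add,
      add_mul, smul_mul_assoc, mul_smul_comm, one_mul, mul_one]
    module

end Hull

/-! ### The mutually inverse homomorphisms between F^♯ and B(Φ[T], D, t₀). -/

section UnitalHullIso

open MvPolynomial

variable {Φ : Type u} [Field Φ]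

instance unitization_isScalarTower {A : Type v} [NonUnitalNonAssocRing A] [Module Φ A]
    [IsScalarTower Φ A A] : IsScalarTower Φ (Unitization Φ A) (Unitization Φ A) where
  smul_assoc r y z := by
    refine Unitization.ext ?_ ?_
    · simp only [smul_eq_mul, Unitization.fst_mul, Unitization.fst_smul]
      ring
    · simp only [smul_eq_mul, Unitization.snd_mul, Unitization.fst_smul, Unitization.snd_smul,
        smul_mul_assoc, smul_add]
      module

instance unitization_smulCommClass {A : Type v} [NonUnitalNonAssocRing A] [Module Φ A]
    [SMulCommClass Φ A A] : SMulCommClass Φ (Unitization Φ A) (Unitization Φ A) where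
  smul_comm r y z := by
    refine Unitization.ext ?_ ?_
    · simp only [smul_eq_mul, Unitization.fst_mul, Unitization.fst_smul]
      ring
    · simp only [smul_eq_mul, Unitization.snd_mul, Unitization.fst_smul, Unitization.snd_smul,
        mul_smul_comm, smul_add]
      module

theorem VectorType.fst_incl (a : MvPolynomial ℕ Φ) :
    VectorType.fstₗ _ _ (VectorType.incl (shiftDerivation Φ) (X 0) a) = a := rfl

theorem VectorType.snd_incl (a : MvPolynomial ℕ Φ) :
    VectorType.sndₗ _ _ (VectorType.incl (shiftDerivation Φ) (X 0) a) = 0 := rfl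

theorem VectorType.fst_bar (a : MvPolynomial ℕ Φ) :
    VectorType.fstₗ _ _ (VectorType.bar (shiftDerivation Φ) (X 0) a) = 0 := rfl

theorem VectorType.snd_bar (a : MvPolynomial ℕ Φ) :
    VectorType.sndₗ _ _ (VectorType.bar (shiftDerivation Φ) (X 0) a) = a := rfl

theorem VectorType.incl_mul (a b : MvPolynomial ℕ Φ) :
    VectorType.incl (shiftDerivation Φ) (X 0) (a * b) =
      VectorType.incl (shiftDerivation Φ) (X 0) a * VectorType.incl (shiftDerivation Φ) (X 0) b := by
  apply VectorType.ext_coord <;> simp [fst_incl, snd_incl]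

theorem polyVectorTypeZeroGrading_mul_mem (i j : ZMod 2) (a b : polyVectorTypeZero Φ)
    (ha : a ∈ polyVectorTypeZeroGrading Φ i) (hb : b ∈ polyVectorTypeZeroGrading Φ j) :
    a * b ∈ polyVectorTypeZeroGrading Φ (i + j) :=
  VectorType.grading_mul_mem i j _ _ ha hb

theorem polyVectorTypeZeroGrading_superidentities :
    HasMinusOneOneSuperidentities (polyVectorTypeZeroGrading Φ) where
  right_alternative i j k _ _ _ ha hb hc :=
    Subtype.ext (VectorType.hasMinusOneOneSuperidentities.right_alternative i j k _ _ _ ha hb hc)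
  cyclic i j k _ _ _ ha hb hc :=
    Subtype.ext (VectorType.hasMinusOneOneSuperidentities.cyclic i j k _ _ _ ha hb hc)

theorem barOne_mem : barOne Φ ∈ polyVectorTypeZeroGrading Φ 1 :=
  VectorType.mem_grading_one.2 rfl

variable (Φ) in
/-- The canonical homomorphism from the free superalgebra to `B₀(Φ[T], D, t₀)`. -/
def toPolyVectorTypeZero : FreeMinusOneOne Φ →ₙₐ[Φ] polyVectorTypeZero Φ :=
  FreeMinusOneOne.lift polyVectorTypeZeroGrading_superidentities polyVectorTypeZeroGrading_mul_mem
    barOne_mem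

variable (Φ) in
/-- The canonical homomorphism from the unital hull of the free superalgebra to
`B(Φ[T], D, t₀)`. -/
def hullToPolyVectorType : Unitization Φ (FreeMinusOneOne Φ) →ₙₐ[Φ] PolyVectorType Φ :=
  unitizationLift ((NonUnitalSubalgebraClass.subtype (polyVectorTypeZero Φ)).comp
    (toPolyVectorTypeZero Φ))

theorem hullToPolyVectorType_apply (y : Unitization Φ (FreeMinusOneOne Φ)) :
    hullToPolyVectorType Φ y = y.fst • 1 + (toPolyVectorTypeZero Φ y.snd : PolyVectorType Φ) := rfl

theorem hullToPolyVectorType_one : hullToPolyVectorType Φ 1 = 1 := by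
  rw [hullToPolyVectorType_apply]
  simp

theorem hullToPolyVectorType_inr (a : FreeMinusOneOne Φ) :
    hullToPolyVectorType Φ (Unitization.inr a) = toPolyVectorTypeZero Φ a := by
  rw [hullToPolyVectorType_apply]
  simp

theorem toPolyVectorTypeZero_gen : toPolyVectorTypeZero Φ (FreeMinusOneOne.gen Φ) = barOne Φ :=
  FreeMinusOneOne.lift_gen _ _ _

theorem hullToPolyVectorType_gen :
    hullToPolyVectorType Φ (Unitization.inr (FreeMinusOneOne.gen Φ)) =
      VectorType.bar (shiftDerivation Φ) (X 0) 1 := by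
  rw [hullToPolyVectorType_inr, toPolyVectorTypeZero_gen]
  rfl

theorem hullToPolyVectorType_mem (i : ZMod 2) (y : Unitization Φ (FreeMinusOneOne Φ))
    (hy : y ∈ hullGrading (FreeMinusOneOne.grading Φ) i) :
    hullToPolyVectorType Φ y ∈ VectorType.grading (shiftDerivation Φ) (X 0) i := by
  rw [mem_hullGrading] at hy
  rw [hullToPolyVectorType_apply]
  refine add_mem ?_ (FreeMinusOneOne.lift_mem polyVectorTypeZeroGrading_superidentities
    polyVectorTypeZeroGrading_mul_mem barOne_mem i _ hy.1)
  rcases hy.2 with rfl | h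
  · exact Submodule.smul_mem _ _ (VectorType.mem_grading_zero.2 rfl)
  · rw [h, zero_smul]; exact zero_mem _

variable (Φ) in
/-- The inclusion of an algebra in its unital hull. -/
def freeInr : FreeMinusOneOne Φ →ₙₐ[Φ] Unitization Φ (FreeMinusOneOne Φ) :=
  { Unitization.inrHom Φ Φ (FreeMinusOneOne Φ) with
    map_zero' := Unitization.inr_zero Φ
    map_mul' := Unitization.inr_mul Φ }

theorem inr_gen_mem : (Unitization.inr (FreeMinusOneOne.gen Φ) : Unitization Φ (FreeMinusOneOne Φ))
    ∈ hullGrading (FreeMinusOneOne.grading Φ) 1 := inr_mem_hullGrading.2 FreeMinusOneOne.gen_mem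

/-- The homomorphism from `B(Φ[T], D, t₀)` to the unital hull of the free superalgebra. -/
def polyVectorTypeToHull (h2 : (2 : Φ) ≠ 0) (h3 : (3 : Φ) ≠ 0) :
    PolyVectorType Φ →ₙₐ[Φ] Unitization Φ (FreeMinusOneOne Φ) :=
  polyVectorTypeLift h2 h3 (hullGrading_superidentities FreeMinusOneOne.superidentities)
    (hullGrading_mul_mem FreeMinusOneOne.grading_mul_mem) one_mem_hullGrading inr_gen_mem

theorem polyVectorTypeToHull_apply (h2 : (2 : Φ) ≠ 0) (h3 : (3 : Φ) ≠ 0) (p : PolyVectorType Φ) :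
    polyVectorTypeToHull h2 h3 p =
      jetEven Φ (Unitization.inr (FreeMinusOneOne.gen Φ)) (VectorType.fstₗ _ _ p) +
      jetOdd Φ (Unitization.inr (FreeMinusOneOne.gen Φ)) (VectorType.sndₗ _ _ p) := rfl

theorem polyVectorTypeToHull_incl (h2 : (2 : Φ) ≠ 0) (h3 : (3 : Φ) ≠ 0) (a : MvPolynomial ℕ Φ) :
    polyVectorTypeToHull h2 h3 (VectorType.incl _ _ a) =
      jetEven Φ (Unitization.inr (FreeMinusOneOne.gen Φ)) a := by
  rw [polyVectorTypeToHull_apply, show VectorType.fstₗ _ _ (VectorType.incl _ _ a) = a from rfl,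
    show VectorType.sndₗ (shiftDerivation Φ) (X 0) (VectorType.incl _ _ a) = 0 from rfl, map_zero,
    add_zero]

theorem polyVectorTypeToHull_bar (h2 : (2 : Φ) ≠ 0) (h3 : (3 : Φ) ≠ 0) (a : MvPolynomial ℕ Φ) :
    polyVectorTypeToHull h2 h3 (VectorType.bar _ _ a) =
      jetOdd Φ (Unitization.inr (FreeMinusOneOne.gen Φ)) a := by
  rw [polyVectorTypeToHull_apply, show VectorType.sndₗ _ _ (VectorType.bar _ _ a) = a from rfl,
    show VectorType.fstₗ (shiftDerivation Φ) (X 0) (VectorType.bar _ _ a) = 0 from rfl, map_zero,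
    zero_add]

theorem polyVectorTypeToHull_mem (h2 : (2 : Φ) ≠ 0) (h3 : (3 : Φ) ≠ 0) (i : ZMod 2)
    (p : PolyVectorType Φ) (hp : p ∈ VectorType.grading (shiftDerivation Φ) (X 0) i) :
    polyVectorTypeToHull h2 h3 p ∈ hullGrading (FreeMinusOneOne.grading Φ) i := by
  have hmul := hullGrading_mul_mem (FreeMinusOneOne.grading_mul_mem (Φ := Φ))
  rw [polyVectorTypeToHull_apply]
  rcases zmod_two_eq i with rfl | rfl
  · rw [VectorType.mem_grading_zero.1 hp, map_zero, add_zero]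
    exact jetEven_mem hmul one_mem_hullGrading inr_gen_mem _
  · rw [VectorType.mem_grading_one.1 hp, map_zero, zero_add]
    exact jetOdd_mem hmul one_mem_hullGrading inr_gen_mem _

/-- On F the composite agrees with the inclusion because both fix the generator, and it also fixes
1. -/
theorem polyVectorTypeToHull_hullToPolyVectorType (h2 : (2 : Φ) ≠ 0) (h3 : (3 : Φ) ≠ 0)
    (y : Unitization Φ (FreeMinusOneOne Φ)) :
    polyVectorTypeToHull h2 h3 (hullToPolyVectorType Φ y) = y := by
  have e1 : ((polyVectorTypeToHull h2 h3).comp (hullToPolyVectorType Φ)).comp (freeInr Φ) =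
      freeInr Φ := by
    apply FreeMinusOneOne.hom_ext
    change polyVectorTypeToHull h2 h3 (hullToPolyVectorType Φ (Unitization.inr _)) =
      Unitization.inr _
    rw [hullToPolyVectorType_gen, polyVectorTypeToHull_bar, jetOdd_one]
  have e2 : polyVectorTypeToHull h2 h3 1 = 1 :=
    (polyVectorTypeToHull_incl h2 h3 1).trans (jetEven_one _)
  have e3 : y = y.fst • 1 + Unitization.inr y.snd := by
    refine Unitization.ext ?_ ?_ <;> simp
  conv_lhs => rw [e3]
  rw [map_add, map_smul, hullToPolyVectorType_one, map_add, map_smul, e2]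
  conv_rhs => rw [e3]
  exact congrArg _ (DFunLike.congr_fun e1 y.snd)

/-- In B the defining recursion reads 1̄ × (tᵢ × 1̄) - (1̄ × 1̄) × tᵢ = t₀tᵢ + D(tᵢ) - t₀tᵢ = tᵢ₊₁.
-/
theorem hullToPolyVectorType_jetElem (i : ℕ) : hullToPolyVectorType Φ
    (jetElem (Unitization.inr (FreeMinusOneOne.gen Φ)) i) = VectorType.incl _ _ (X i) := by
  induction i with
  | zero =>
    rw [jetElem, map_mul, hullToPolyVectorType_gen]
    apply VectorType.ext_coord <;>
      simp [VectorType.fst_incl, VectorType.snd_incl, VectorType.fst_bar, VectorType.snd_bar]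
  | succ i ih =>
    rw [jetElem, map_sub, map_mul, map_mul, map_mul, map_mul, hullToPolyVectorType_gen, ih]
    apply VectorType.ext_coord <;>
      simp [VectorType.fst_incl, VectorType.snd_incl, VectorType.fst_bar, VectorType.snd_bar,
        shiftDerivation_X]

/-- Both maps are multiplicative, so it is enough to follow 1, the tᵢ and 1̄, using ā = a × 1̄. -/
theorem hullToPolyVectorType_polyVectorTypeToHull (h2 : (2 : Φ) ≠ 0) (h3 : (3 : Φ) ≠ 0)
    (p : PolyVectorType Φ) : hullToPolyVectorType Φ (polyVectorTypeToHull h2 h3 p) = p := by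
  have key : ∀ a, hullToPolyVectorType Φ (jetEven Φ (Unitization.inr (FreeMinusOneOne.gen Φ)) a) =
      VectorType.incl _ _ a := by
    intro a
    induction a using MvPolynomial.induction_on with
    | C r =>
      rw [← mul_one (C r), ← smul_eq_C_mul, map_smul, map_smul, map_smul, jetEven_one,
        hullToPolyVectorType_one]
      rfl
    | add a b ha hb => rw [map_add, map_add, map_add, ha, hb]
    | mul_X a i ha =>
      rw [← polyVectorTypeToHull_incl h2 h3, VectorType.incl_mul, map_mul, map_mul,
        polyVectorTypeToHull_incl, polyVectorTypeToHull_incl, ha, jetEven_X,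
        hullToPolyVectorType_jetElem]
  rw [polyVectorTypeToHull_apply, map_add, jetOdd_apply, map_mul, key, key,
    hullToPolyVectorType_gen]
  apply VectorType.ext_coord <;>
    simp [VectorType.fst_incl, VectorType.snd_incl, VectorType.fst_bar, VectorType.snd_bar]

/-- The sum of the two parts of F is direct because it is direct in B: an element of both parts has
image 0 there, and F^♯ → B has a left inverse. -/
theorem freeMinusOneOne_isMinusOneOneSuperalgebra (h2 : (2 : Φ) ≠ 0) (h3 : (3 : Φ) ≠ 0) :
    IsMinusOneOneSuperalgebra (FreeMinusOneOne.grading Φ) := by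
  refine FreeMinusOneOne.superidentities.isMinusOneOneSuperalgebra h2
    ⟨⟨?_, codisjoint_iff.2 FreeMinusOneOne.grading_codisjoint⟩, FreeMinusOneOne.grading_mul_mem⟩
  rw [Submodule.disjoint_def]
  intro a h0 h1
  have m0 := hullToPolyVectorType_mem 0 _ (inr_mem_hullGrading.2 h0)
  have m1 := hullToPolyVectorType_mem 1 _ (inr_mem_hullGrading.2 h1)
  have e := polyVectorTypeToHull_hullToPolyVectorType h2 h3 (Unitization.inr a)
  rw [VectorType.ext_coord (VectorType.mem_grading_one.1 m1) (VectorType.mem_grading_zero.1 m0)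
    (y := 0), map_zero] at e
  exact Unitization.inr_injective e.symm

/-- The scalar component is the constant term of the even coordinate of the image in B, as F itself
lands in B₀. This is what cuts the isomorphism F^♯ ≅ B down to F ≅ B₀. -/
theorem fst_polyVectorTypeToHull (h2 : (2 : Φ) ≠ 0) (h3 : (3 : Φ) ≠ 0) (p : polyVectorTypeZero Φ) :
    (polyVectorTypeToHull h2 h3 (p : PolyVectorType Φ)).fst = 0 := by
  have e := hullToPolyVectorType_polyVectorTypeToHull h2 h3 (p : PolyVectorType Φ)
  rw [hullToPolyVectorType_apply] at e
  have e' := congrArg (fun q => constantCoeff (VectorType.fstₗ (shiftDerivation Φ) (X 0) q)) e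
  have hp : constantCoeff (VectorType.fstₗ (shiftDerivation Φ) (X 0) (p : PolyVectorType Φ)) = 0 :=
    p.2
  have hq := (toPolyVectorTypeZero Φ (polyVectorTypeToHull h2 h3 (p : PolyVectorType Φ)).snd).2
  change constantCoeff (VectorType.fstₗ (shiftDerivation Φ) (X 0) _) = 0 at hq
  simp only [map_add, map_smul, hp, hq, VectorType.fst_one, add_zero, smul_eq_C_mul, mul_one,
    constantCoeff_C] at e'
  exact e'

end UnitalHullIso

end

/-! ### The main theorem. -/

theorem theorem3p1 (Φ : Type u) [Field Φ] (h2 : ringChar Φ ≠ 2) (h3 : ringChar Φ ≠ 3) :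
    -- `F` is the free superalgebra on the odd generator `x`
    IsFreeOnOddGenerator.{u, u, w} (FreeMinusOneOne.grading Φ) (FreeMinusOneOne.gen Φ) ∧
    -- `F ≅ B₀(Φ[T], D, t₀)` with `x ↦ 1̄`
    (∃ f : FreeMinusOneOne Φ →ₙₐ[Φ] polyVectorTypeZero Φ,
      IsSuperalgebraIso (FreeMinusOneOne.grading Φ) (polyVectorTypeZeroGrading Φ) f ∧
      f (FreeMinusOneOne.gen Φ) = barOne Φ) ∧
    -- `F^♯ ≅ B(Φ[T], D, t₀)` with `1 ↦ 1` and `x ↦ 1̄`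
    (∃ g : Unitization Φ (FreeMinusOneOne Φ) →ₙₐ[Φ] PolyVectorType Φ,
      IsSuperalgebraIso (hullGrading (FreeMinusOneOne.grading Φ))
        (VectorType.grading (shiftDerivation Φ) (MvPolynomial.X 0)) g ∧
      g 1 = 1 ∧
      g (Unitization.inr (FreeMinusOneOne.gen Φ)) =
        VectorType.bar (shiftDerivation Φ) (MvPolynomial.X 0) 1) := by
  have h2' : (2 : Φ) ≠ 0 := Ring.two_ne_zero h2
  have h3' : (3 : Φ) ≠ 0 := by
    intro h
    have hd : ringChar Φ ∣ 3 := ringChar.dvd (by exact_mod_cast h)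
    rcases (Nat.dvd_prime Nat.prime_three).1 hd with h1 | h1
    · exact CharP.ringChar_ne_one h1
    · exact h3 h1
  have hleft := polyVectorTypeToHull_hullToPolyVectorType h2' h3'
  have hright := hullToPolyVectorType_polyVectorTypeToHull h2' h3'
  have hmem : ∀ i y, hullToPolyVectorType Φ y ∈
      VectorType.grading (shiftDerivation Φ) (MvPolynomial.X 0) i ↔
      y ∈ hullGrading (FreeMinusOneOne.grading Φ) i := by
    refine fun i y => ⟨fun h => ?_, hullToPolyVectorType_mem i y⟩
    have := polyVectorTypeToHull_mem h2' h3' i _ h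
    rwa [hleft] at this
  refine ⟨⟨freeMinusOneOne_isMinusOneOneSuperalgebra h2' h3', FreeMinusOneOne.gen_mem, ?_⟩,
    ⟨toPolyVectorTypeZero Φ, ⟨⟨?_, ?_⟩, ?_⟩, toPolyVectorTypeZero_gen⟩,
    ⟨hullToPolyVectorType Φ, ⟨⟨?_, ?_⟩, hmem⟩, hullToPolyVectorType_one, hullToPolyVectorType_gen⟩⟩
  · intro B _ _ _ _ ℬ hℬ b hb
    have hid := hℬ.superidentities
    have hmul := hℬ.choose.mul_mem
    refine ⟨FreeMinusOneOne.lift hid hmul hb, ⟨FreeMinusOneOne.lift_mem hid hmul hb,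
      FreeMinusOneOne.lift_gen hid hmul hb⟩, fun f hf => FreeMinusOneOne.hom_ext ?_⟩
    rw [hf.2, FreeMinusOneOne.lift_gen]
  · intro a b hab
    apply Unitization.inr_injective (R := Φ)
    rw [← hleft (Unitization.inr a), ← hleft (Unitization.inr b), hullToPolyVectorType_inr,
      hullToPolyVectorType_inr, hab]
  · intro p
    refine ⟨(polyVectorTypeToHull h2' h3' (p : PolyVectorType Φ)).snd, Subtype.ext ?_⟩
    have e := hright (p : PolyVectorType Φ)
    rwa [hullToPolyVectorType_apply, fst_polyVectorTypeToHull, zero_smul, zero_add] at e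
  · intro i a
    rw [← inr_mem_hullGrading (𝒜 := FreeMinusOneOne.grading Φ), ← hmem, hullToPolyVectorType_inr]
    rfl
  · exact Function.LeftInverse.injective hleft
  · exact Function.RightInverse.surjective hright
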